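/- Let $X_0, X_1$ be Banach spaces with $X_1\hookrightarrow X_0$ continuously and densely, let $p\in(1,\infty)$ and $t_0\in\mathbb R$. For an interval $I$ put $E_1(I)=W^{1,p}(I;X_0)\cap L^p(I;X_1)$ with norm $\|u\|_{E_1(I)}=\|u\|_{L^p(I;X_0)}+\|u'\|_{L^p(I;X_0)}+\|u\|_{L^p(I;X_1)}$, its elements being identified with their continuous representatives. Let $X_p=(X_0,X_1)_{1-1/p,p}$ be the real interpolation space, normed by $\|x\|_{X_p}=\inf\{\|F\|_{E_1([0,\infty))}: F(0)=x\}$. An operator $B\in\mathcal L(X_1,X_0)$ has maximal $L^p$-regularity on $[a,b]$ if for every $g\in L^p([a,b];X_0)$ there is exactly one $u\in E_1([a,b])$ with $u'+Bu=g$ a.e. on $[a,b]$ and $u(a)=0$. For each $n\in\mathbb N\cup\{\infty\}$ let $A_n:[t_0,\infty)\times X_p\to\mathcal L(X_1,X_0)$, $f_n:[t_0,\infty)\times X_p\to X_0$ and $u_0^n\in X_p$ be such that: (I.a) $A_n$ is continuous; $t\mapsto f_n(t,u)$ is (strongly) measurable for every $u\in X_p$, and $u\mapsto f_n(t,u)$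 is continuous for almost every $t\ge t_0$; (I.b) for every $R>0$ there is $L_R^n>0$ with $\|A_n(t,u_1)v-A_n(t,u_2)v\|_{X_0}\le L_R^n\|u_1-u_2\|_{X_p}\|v\|_{X_1}$ for all $t\in[t_0,t_0+R]$, all $u_1,u_2\in X_p$ of norm at most $R$, and all $v\in X_1$; (I.c) $f_n(\cdot,0)\in L^p_{\rm loc}([t_0,\infty);X_0)$; (I.d) for every $R>0$ there is $\Psi_R^n\in L^p_{\rm loc}([t_0,\infty))$ such that for all $u_1,u_2\in X_p$ of norm at most $R$ one has $\|f_n(t,u_1)-f_n(t,u_2)\|_{X_0}\le\Psi_R^n(t)\|u_1-u_2\|_{X_p}$ for almost every $t\ge t_0$; (I.e) for all $t\ge t_0$ and $u\in X_p$, the operator $A_n(t,u)$ has maximal $L^p$-regularity on every compact interval $[a,b]$, $a<b$. Suppose that for every $\varepsilon>0$, every compact interval $K\subset[t_0,\infty)$ and every $\eta>0$ there is $N$ such that for all finite $n\ge N$ $$\sup_{t\in K}\sup_{\|u\|_{X_p}\le\eta}\|f_n(t,u)-f_\infty(t,u)\|_{X_0}<\varepsilon,\qquad \sup_{t\in K}\sup_{\|u\|_{X_p}\le\eta}\|A_n(t,u)-A_\infty(t,u)\|_{\mathcal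 L(X_1,X_0)}<\varepsilon,$$ and that $\|u_0^n-u_0^\infty\|_{X_p}\to0$ as $n\to\infty$. For $n\in\mathbb N\cup\{\infty\}$ let $\phi_n$ be the solution of $$\frac{d\phi_n}{dt}+A_n(t,\phi_n)\phi_n=f_n(t,\phi_n)\ \text{ for a.e. } t>t_0,\qquad \phi_n(t_0)=u_0^n,$$ on its maximal interval of existence $[t_0,t_0+T_n)$, $T_n\le\infty$; that is, $\phi_n\in E_1(I)$ for every compact interval $I\subset[t_0,t_0+T_n)$, and $\phi_n$ cannot be extended to such a solution on a longer interval. Then: 1. for every compact interval $K\subset[t_0,t_0+T_\infty)$ one has $K\subset[t_0,t_0+T_n)$ for all sufficiently large $n$, and $\lim_{n\to\infty}\|\phi_n-\phi_\infty\|_{E_1(K)}=0$; 2. $T_\infty\le\limsup_{n\to\infty}T_n$. -/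

import Mathlib

open MeasureTheory Set Filter Topology
open scoped ENNReal

namespace MaxReg

variable {X₀ X₁ : Type*} [NormedAddCommGroup X₀] [NormedSpace ℝ X₀]
  [NormedAddCommGroup X₁] [NormedSpace ℝ X₁]

/-! ### The spaces `E₁(I) = W^{1,p}(I; X₀) ∩ L^p(I; X₁)`

The Banach space `X₁` is embedded in `X₀` by the continuous linear map `j`. -/

/-- `u` is (the continuous representative of) an element of `W^{1,p}(I; X₀) ∩ L^p(I; X₁)` on the
interval `I`, with derivative `du ∈ L^p(I; X₀)`; the function `v ∈ L^p(I; X₁)` is `u` regarded as an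
`X₁`-valued function. -/
structure IsE1Rep (j : X₁ →L[ℝ] X₀) (p : ℝ≥0∞) (I : Set ℝ) (u du : ℝ → X₀) (v : ℝ → X₁) :
    Prop where
  memLp : MemLp u p (volume.restrict I)
  memLp_deriv : MemLp du p (volume.restrict I)
  memLp_dom : MemLp v p (volume.restrict I)
  sub_eq_integral : ∀ s ∈ I, ∀ t ∈ I, u t - u s = ∫ r in s..t, du r
  embed_ae_eq : ∀ᵐ t ∂(volume.restrict I), j (v t) = u t

/-- The norm of `E₁(I)`, that is `‖u‖_{L^p(I; X₀)} + ‖u'‖_{L^p(I; X₀)} + ‖u‖_{L^p(I; X₁)}`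
(equal to `∞` if `u` does not belong to `E₁(I)`). The infimum runs over the derivatives and the
`X₁`-valued versions of `u`, which are unique up to null sets. -/
noncomputable def e1Norm (j : X₁ →L[ℝ] X₀) (p : ℝ≥0∞) (I : Set ℝ) (u : ℝ → X₀) : ℝ≥0∞ :=
  ⨅ (du : ℝ → X₀) (v : ℝ → X₁) (_ : IsE1Rep j p I u du v),
    eLpNorm u p (volume.restrict I) + eLpNorm du p (volume.restrict I)
      + eLpNorm v p (volume.restrict I)

namespace IsE1Rep

variable {j : X₁ →L[ℝ] X₀} {p : ℝ≥0∞} {I : Set ℝ} {u du u' du' : ℝ → X₀} {v v' : ℝ → X₁}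

theorem intervalIntegrable [hp : Fact (1 ≤ p)] [hI : I.OrdConnected] (h : IsE1Rep j p I u du v)
    {s t : ℝ} (hs : s ∈ I) (ht : t ∈ I) : IntervalIntegrable du volume s t := by
  rw [intervalIntegrable_iff]
  have hsub : Set.uIoc s t ⊆ I := Set.uIoc_subset_uIcc.trans (hI.uIcc_subset hs ht)
  have h1 : MemLp du p (volume.restrict (Set.uIoc s t)) :=
    h.memLp_deriv.mono_measure (Measure.restrict_mono hsub le_rfl)
  have : IsFiniteMeasure (volume.restrict (Set.uIoc s t)) :=
    ⟨by rw [Measure.restrict_apply_univ, Set.uIoc]; exact measure_Ioc_lt_top⟩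
  exact h1.integrable hp.out

theorem zero : IsE1Rep j p I (0 : ℝ → X₀) 0 0 where
  memLp := MemLp.zero
  memLp_deriv := MemLp.zero
  memLp_dom := MemLp.zero
  sub_eq_integral := by simp
  embed_ae_eq := by simp

theorem add [Fact (1 ≤ p)] [I.OrdConnected] (h : IsE1Rep j p I u du v)
    (h' : IsE1Rep j p I u' du' v') : IsE1Rep j p I (u + u') (du + du') (v + v') where
  memLp := h.memLp.add h'.memLp
  memLp_deriv := h.memLp_deriv.add h'.memLp_deriv
  memLp_dom := h.memLp_dom.add h'.memLp_dom
  sub_eq_integral := by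
    intro s hs t ht
    have := intervalIntegral.integral_add (h.intervalIntegrable hs ht)
      (h'.intervalIntegrable hs ht)
    simp only [Pi.add_apply]
    rw [this, ← h.sub_eq_integral s hs t ht, ← h'.sub_eq_integral s hs t ht]
    abel
  embed_ae_eq := by
    filter_upwards [h.embed_ae_eq, h'.embed_ae_eq] with t h1 h2
    simp [h1, h2]

theorem smul (c : ℝ) (h : IsE1Rep j p I u du v) :
    IsE1Rep j p I (c • u) (c • du) (c • v) where
  memLp := h.memLp.const_smul c
  memLp_deriv := h.memLp_deriv.const_smul c
  memLp_dom := h.memLp_dom.const_smul c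
  sub_eq_integral := by
    intro s hs t ht
    simp only [Pi.smul_apply]
    rw [intervalIntegral.integral_smul, ← h.sub_eq_integral s hs t ht, smul_sub]
  embed_ae_eq := by
    filter_upwards [h.embed_ae_eq] with t h1
    simp [h1]

end IsE1Rep

section E1Norm

variable {j : X₁ →L[ℝ] X₀} {p : ℝ≥0∞} {I : Set ℝ}

theorem e1Norm_le {u du : ℝ → X₀} {v : ℝ → X₁} (h : IsE1Rep j p I u du v) :
    e1Norm j p I u ≤ eLpNorm u p (volume.restrict I) + eLpNorm du p (volume.restrict I)
      + eLpNorm v p (volume.restrict I) :=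
  iInf_le_of_le du (iInf_le_of_le v (iInf_le_of_le h le_rfl))

theorem e1Norm_lt_top_of_rep {u du : ℝ → X₀} {v : ℝ → X₁} (h : IsE1Rep j p I u du v) :
    e1Norm j p I u < ∞ :=
  (e1Norm_le h).trans_lt
    (ENNReal.add_lt_top.2 ⟨ENNReal.add_lt_top.2 ⟨h.memLp.2, h.memLp_deriv.2⟩, h.memLp_dom.2⟩)

theorem e1Norm_zero : e1Norm j p I (0 : ℝ → X₀) = 0 := by
  refine le_antisymm ((e1Norm_le IsE1Rep.zero).trans ?_) bot_le
  simp

theorem e1Norm_add_le [hp : Fact (1 ≤ p)] [I.OrdConnected] (u u' : ℝ → X₀) :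
    e1Norm j p I (u + u') ≤ e1Norm j p I u + e1Norm j p I u' := by
  conv_rhs => unfold e1Norm
  simp only [ENNReal.iInf_add, ENNReal.add_iInf]
  refine le_iInf fun du' => le_iInf fun v' => le_iInf fun h' => le_iInf fun du =>
    le_iInf fun v => le_iInf fun h => ?_
  refine (e1Norm_le (h.add h')).trans ?_
  have h1 := eLpNorm_add_le h.memLp.1 h'.memLp.1 hp.out
  have h2 := eLpNorm_add_le h.memLp_deriv.1 h'.memLp_deriv.1 hp.out
  have h3 := eLpNorm_add_le h.memLp_dom.1 h'.memLp_dom.1 hp.out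
  refine (add_le_add (add_le_add h1 h2) h3).trans (le_of_eq ?_)
  ring

theorem e1Norm_smul_le (c : ℝ) (u : ℝ → X₀) :
    e1Norm j p I (c • u) ≤ ‖c‖ₑ * e1Norm j p I u := by
  rcases eq_or_ne c 0 with rfl | hc
  · simp [e1Norm_zero]
  have hc' : ‖c‖ₑ ≠ 0 := by simpa using hc
  conv_rhs => unfold e1Norm
  simp only [ENNReal.mul_iInf_of_ne hc' enorm_ne_top]
  refine le_iInf fun du => le_iInf fun v => le_iInf fun h => ?_
  refine (e1Norm_le (h.smul c)).trans ?_
  rw [eLpNorm_const_smul, eLpNorm_const_smul, eLpNorm_const_smul, mul_add, mul_add]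

theorem enorm_zero_le_e1Norm [hp : Fact (1 ≤ p)] (u : ℝ → X₀) :
    ‖u 0‖ₑ ≤ e1Norm j p (Ici (0 : ℝ)) u := by
  refine le_iInf fun du => le_iInf fun v => le_iInf fun h => ?_
  set μ : Measure ℝ := volume.restrict (Icc (0 : ℝ) 1) with hμ
  have hle : μ ≤ volume.restrict (Ici (0 : ℝ)) :=
    Measure.restrict_mono (fun x hx => hx.1) le_rfl
  have hprob : IsProbabilityMeasure μ := ⟨by simp [hμ]⟩
  have hu := h.memLp.mono_measure hle
  have hdu := h.memLp_deriv.mono_measure hle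
  have key : ∀ t ∈ Icc (0 : ℝ) 1, ‖u 0‖ₑ ≤ ‖u t‖ₑ + ∫⁻ r, ‖du r‖ₑ ∂μ := by
    intro t ht
    have e1 : u 0 = u t - ∫ r in (0 : ℝ)..t, du r := by
      rw [← h.sub_eq_integral 0 self_mem_Ici t ht.1]; abel
    have e2 : ‖∫ r in (0 : ℝ)..t, du r‖ₑ ≤ ∫⁻ r, ‖du r‖ₑ ∂μ := by
      rw [intervalIntegral.integral_of_le ht.1]
      refine (enorm_integral_le_lintegral_enorm _).trans ?_
      have hsub : Ioc (0 : ℝ) t ⊆ Icc 0 1 := fun x hx => ⟨hx.1.le, hx.2.trans ht.2⟩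
      exact lintegral_mono' (Measure.restrict_mono hsub le_rfl) le_rfl
    rw [e1]
    exact (enorm_sub_le).trans (add_le_add le_rfl e2)
  have h2 : ∫⁻ _, ‖u 0‖ₑ ∂μ ≤ ∫⁻ t, (‖u t‖ₑ + ∫⁻ r, ‖du r‖ₑ ∂μ) ∂μ := by
    refine lintegral_mono_ae ?_
    filter_upwards [ae_restrict_mem measurableSet_Icc] with t ht using key t ht
  rw [lintegral_add_right _ measurable_const] at h2
  simp only [lintegral_const, measure_univ, mul_one] at h2
  rw [← eLpNorm_one_eq_lintegral_enorm, ← eLpNorm_one_eq_lintegral_enorm] at h2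
  refine h2.trans (le_trans ?_ le_self_add)
  refine add_le_add ?_ ?_
  · exact (eLpNorm_le_eLpNorm_of_exponent_le hp.out hu.1).trans (eLpNorm_mono_measure _ hle)
  · exact (eLpNorm_le_eLpNorm_of_exponent_le hp.out hdu.1).trans (eLpNorm_mono_measure _ hle)

end E1Norm

/-! ### The real interpolation space `X_p = (X₀, X₁)_{1 - 1/p, p}`

It is the space of initial values of functions in `E₁([0, ∞))`, with the quotient norm. -/

/-- The infimum of `‖F‖_{E₁([0, ∞))}` over all `F` with `F 0 = x`. -/
noncomputable def traceENorm (j : X₁ →L[ℝ] X₀) (p : ℝ≥0∞) (x : X₀) : ℝ≥0∞ :=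
  ⨅ (F : ℝ → X₀) (_ : F 0 = x), e1Norm j p (Ici (0 : ℝ)) F

section Trace

variable {j : X₁ →L[ℝ] X₀} {p : ℝ≥0∞}

theorem traceENorm_le {F : ℝ → X₀} {x : X₀} (hF : F 0 = x) :
    traceENorm j p x ≤ e1Norm j p (Ici (0 : ℝ)) F :=
  iInf_le_of_le F (iInf_le_of_le hF le_rfl)

theorem traceENorm_zero : traceENorm j p (0 : X₀) = 0 := by
  refine le_antisymm ((traceENorm_le (F := 0) rfl).trans ?_) bot_le
  simp [e1Norm_zero]

theorem traceENorm_add_le [Fact (1 ≤ p)] (x y : X₀) :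
    traceENorm j p (x + y) ≤ traceENorm j p x + traceENorm j p y := by
  conv_rhs => unfold traceENorm
  simp only [ENNReal.iInf_add, ENNReal.add_iInf]
  refine le_iInf fun G => le_iInf fun hG => le_iInf fun F => le_iInf fun hF => ?_
  refine (traceENorm_le (F := F + G) (by simp [hF, hG])).trans ?_
  exact e1Norm_add_le F G

theorem traceENorm_smul_le (c : ℝ) (x : X₀) :
    traceENorm j p (c • x) ≤ ‖c‖ₑ * traceENorm j p x := by
  rcases eq_or_ne c 0 with rfl | hc
  · simp [traceENorm_zero]
  have hc' : ‖c‖ₑ ≠ 0 := by simpa using hc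
  conv_rhs => unfold traceENorm
  simp only [ENNReal.mul_iInf_of_ne hc' enorm_ne_top]
  refine le_iInf fun F => le_iInf fun hF => ?_
  refine (traceENorm_le (F := c • F) (by simp [hF])).trans ?_
  exact e1Norm_smul_le c F

theorem enorm_le_traceENorm [Fact (1 ≤ p)] (x : X₀) : ‖x‖ₑ ≤ traceENorm j p x := by
  refine le_iInf fun F => le_iInf fun hF => ?_
  rw [← hF]
  exact enorm_zero_le_e1Norm F

end Trace

/-- `X_p` as a linear subspace of `X₀`. -/
def traceSubmodule (j : X₁ →L[ℝ] X₀) (p : ℝ≥0∞) [Fact (1 ≤ p)] : Submodule ℝ X₀ where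
  carrier := {x | traceENorm j p x < ∞}
  zero_mem' := by simp [traceENorm_zero]
  add_mem' := fun {x y} hx hy =>
    (traceENorm_add_le x y).trans_lt (ENNReal.add_lt_top.2 ⟨hx, hy⟩)
  smul_mem' := fun c x hx =>
    (traceENorm_smul_le c x).trans_lt (ENNReal.mul_lt_top enorm_lt_top hx)

/-- The space `X_p`. It carries its own norm, not the one inherited from `X₀`. -/
def Xp (j : X₁ →L[ℝ] X₀) (p : ℝ≥0∞) [Fact (1 ≤ p)] : Type _ := traceSubmodule j p

namespace Xp

variable {j : X₁ →L[ℝ] X₀} {p : ℝ≥0∞} [Fact (1 ≤ p)]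

instance : AddCommGroup (Xp j p) := inferInstanceAs (AddCommGroup (traceSubmodule j p))

instance : Module ℝ (Xp j p) := inferInstanceAs (Module ℝ (traceSubmodule j p))

/-- The inclusion of `X_p` into `X₀`. -/
def toX₀ : Xp j p →ₗ[ℝ] X₀ := (traceSubmodule j p).subtype

theorem toX₀_injective : Function.Injective (toX₀ : Xp j p → X₀) := Subtype.val_injective

theorem traceENorm_lt_top (x : Xp j p) : traceENorm j p (toX₀ x) < ∞ := x.2

/-- The norm of `X_p`: `‖x‖ = inf {‖F‖_{E₁([0, ∞))} : F 0 = x}`. -/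
noncomputable def traceNorm : AddGroupNorm (Xp j p) where
  toFun x := (traceENorm j p (toX₀ x)).toReal
  map_zero' := by simp [traceENorm_zero]
  add_le' x y := by
    rw [← ENNReal.toReal_add x.traceENorm_lt_top.ne y.traceENorm_lt_top.ne, map_add]
    exact ENNReal.toReal_mono
      (ENNReal.add_lt_top.2 ⟨x.traceENorm_lt_top, y.traceENorm_lt_top⟩).ne
      (traceENorm_add_le _ _)
  neg' x := by
    have h : ∀ y : X₀, traceENorm j p (-y) ≤ traceENorm j p y := fun y => by
      simpa using traceENorm_smul_le (j := j) (p := p) (-1) y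
    rw [map_neg, le_antisymm (h (toX₀ x)) (by simpa using h (-toX₀ x))]
  eq_zero_of_map_eq_zero' x hx := by
    have h0 : traceENorm j p (toX₀ x) = 0 :=
      (ENNReal.toReal_eq_zero_iff _).1 hx |>.resolve_right x.traceENorm_lt_top.ne
    have h1 : ‖toX₀ x‖ₑ ≤ 0 := h0 ▸ enorm_le_traceENorm (toX₀ x)
    have h2 : toX₀ x = 0 := by simpa using h1
    exact toX₀_injective (by simpa using h2)

noncomputable instance : NormedAddCommGroup (Xp j p) := traceNorm.toNormedAddCommGroup

theorem norm_def (x : Xp j p) : ‖x‖ = (traceENorm j p (toX₀ x)).toReal := rfl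

noncomputable instance : NormedSpace ℝ (Xp j p) where
  norm_smul_le c x := by
    rw [norm_def, norm_def, ← toReal_enorm c, ← ENNReal.toReal_mul, map_smul]
    exact ENNReal.toReal_mono (ENNReal.mul_lt_top enorm_lt_top x.traceENorm_lt_top).ne
      (traceENorm_smul_le c _)

end Xp

/-! ### Maximal regularity and the evolution equation -/

/-- `u ∈ E₁([a, b])` solves the linear problem `u' + B u = g` a.e. on `[a, b]`, `u(a) = 0`. -/
def IsLinearSolution (j : X₁ →L[ℝ] X₀) (p : ℝ≥0∞) (B : X₁ →L[ℝ] X₀) (a b : ℝ) (g : ℝ → X₀)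
    (u : ℝ → X₀) : Prop :=
  u a = 0 ∧ ∃ (du : ℝ → X₀) (v : ℝ → X₁), IsE1Rep j p (Icc a b) u du v ∧
    ∀ᵐ t ∂(volume.restrict (Icc a b)), du t + B (v t) = g t

/-- Maximal `L^p`-regularity of `B` on `[a, b]`: for every `g ∈ L^p([a, b]; X₀)` the linear problem
has exactly one solution in `E₁([a, b])`. -/
def HasMaximalRegularity (j : X₁ →L[ℝ] X₀) (p : ℝ≥0∞) (B : X₁ →L[ℝ] X₀) (a b : ℝ) : Prop :=
  ∀ g : ℝ → X₀, MemLp g p (volume.restrict (Icc a b)) →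
    (∃ u, IsLinearSolution j p B a b g u) ∧
    ∀ u₁ u₂, IsLinearSolution j p B a b g u₁ → IsLinearSolution j p B a b g u₂ →
      EqOn u₁ u₂ (Icc a b)

/-- The structural assumptions on the operators `A(t, u)` and the right-hand side `f(t, u)` for
`t ≥ t₀` and `u ∈ X_p` (the values for `t < t₀` are irrelevant). -/
structure Assumptions (j : X₁ →L[ℝ] X₀) (p : ℝ≥0∞) [Fact (1 ≤ p)] (t₀ : ℝ)
    (A : ℝ → Xp j p → X₁ →L[ℝ] X₀) (f : ℝ → Xp j p → X₀) : Prop where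
  /-- `A` is continuous on `[t₀, ∞) × X_p`. -/
  continuousOn_A : ContinuousOn (fun z : ℝ × Xp j p => A z.1 z.2) (Ici t₀ ×ˢ univ)
  /-- `f` is measurable in `t`. -/
  measurable_f : ∀ u, AEStronglyMeasurable (fun t => f t u) (volume.restrict (Ici t₀))
  /-- `f` is continuous in `u` for almost every `t`. -/
  continuous_f : ∀ᵐ t ∂(volume.restrict (Ici t₀)), Continuous (f t)
  /-- `A` is Lipschitz continuous in `u` on bounded sets. -/
  lipschitz_A : ∀ R : ℝ, 0 < R → ∃ L : ℝ, 0 < L ∧ ∀ t ∈ Icc t₀ (t₀ + R), ∀ u₁ u₂ : Xp j p,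
    ‖u₁‖ ≤ R → ‖u₂‖ ≤ R → ∀ v : X₁, ‖A t u₁ v - A t u₂ v‖ ≤ L * ‖u₁ - u₂‖ * ‖v‖
  /-- `f(·, 0)` belongs to `L^p_loc([t₀, ∞); X₀)`. -/
  memLp_f_zero : ∀ b : ℝ, MemLp (fun t => f t 0) p (volume.restrict (Icc t₀ b))
  /-- `f` is Lipschitz continuous in `u` on bounded sets, with a constant in
  `L^p_loc([t₀, ∞))`. -/
  lipschitz_f : ∀ R : ℝ, 0 < R → ∃ Ψ : ℝ → ℝ,
    (∀ b : ℝ, MemLp Ψ p (volume.restrict (Icc t₀ b))) ∧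
    ∀ u₁ u₂ : Xp j p, ‖u₁‖ ≤ R → ‖u₂‖ ≤ R →
      ∀ᵐ t ∂(volume.restrict (Ici t₀)), ‖f t u₁ - f t u₂‖ ≤ Ψ t * ‖u₁ - u₂‖
  /-- Every `A(t, u)` has maximal `L^p`-regularity on every compact interval. -/
  maximalRegularity : ∀ t, t₀ ≤ t → ∀ u : Xp j p, ∀ a b : ℝ, a < b →
    HasMaximalRegularity j p (A t u) a b

/-- `φ ∈ E₁([t₀, b])` solves `φ' + A(t, φ) φ = f(t, φ)` a.e. on `[t₀, b]`, `φ(t₀) = u₀`. -/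
def IsSolutionOn (j : X₁ →L[ℝ] X₀) (p : ℝ≥0∞) [Fact (1 ≤ p)] (t₀ : ℝ)
    (A : ℝ → Xp j p → X₁ →L[ℝ] X₀) (f : ℝ → Xp j p → X₀) (u₀ : Xp j p) (b : ℝ)
    (φ : ℝ → Xp j p) : Prop :=
  φ t₀ = u₀ ∧ ∃ (dφ : ℝ → X₀) (v : ℝ → X₁),
    IsE1Rep j p (Icc t₀ b) (fun t => (φ t).toX₀) dφ v ∧
    ∀ᵐ t ∂(volume.restrict (Icc t₀ b)), dφ t + A t (φ t) (v t) = f t (φ t)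

/-- `φ` is a solution on `[t₀, t₀ + T)`, `T ∈ [0, ∞]`: it lies in `E₁` and solves the problem on
every compact subinterval. -/
def IsSolution (j : X₁ →L[ℝ] X₀) (p : ℝ≥0∞) [Fact (1 ≤ p)] (t₀ : ℝ)
    (A : ℝ → Xp j p → X₁ →L[ℝ] X₀) (f : ℝ → Xp j p → X₀) (u₀ : Xp j p) (T : ℝ≥0∞)
    (φ : ℝ → Xp j p) : Prop :=
  ∀ b : ℝ, t₀ ≤ b → ENNReal.ofReal (b - t₀) < T → IsSolutionOn j p t₀ A f u₀ b φ

/-- `φ` is the maximal solution and `[t₀, t₀ + T)` its maximal interval of existence: `φ` is a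
solution there and cannot be extended to a solution on a longer interval. That `T > 0` is not part
of the definition. -/
def IsMaximalSolution (j : X₁ →L[ℝ] X₀) (p : ℝ≥0∞) [Fact (1 ≤ p)] (t₀ : ℝ)
    (A : ℝ → Xp j p → X₁ →L[ℝ] X₀) (f : ℝ → Xp j p → X₀) (u₀ : Xp j p) (T : ℝ≥0∞)
    (φ : ℝ → Xp j p) : Prop :=
  IsSolution j p t₀ A f u₀ T φ ∧
  ∀ (T' : ℝ≥0∞) (ψ : ℝ → Xp j p), IsSolution j p t₀ A f u₀ T' ψ →
    (∀ t, t₀ ≤ t → ENNReal.ofReal (t - t₀) < T → ψ t = φ t) → T' ≤ T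

end MaxReg

open MaxReg

/-! The core is an estimate that is local in time. Fix `s` in the interval of existence of the limit
solution `φ` and freeze `B = A(s, φ(s))`. If `ψ` solves a perturbed problem `(A', f')`, the
difference `w = ψ - φ` satisfies `w' + B w = H`, where `H` is the difference of the terms `f'(ψ) +
(B - A'(ψ)) ψ` and `f(φ) + (B - A(φ)) φ`. After an `E₁` extension of the initial difference is
subtracted, maximal regularity of `B` bounds the `E₁` norm by a multiple of the `L^p` norm of the
right-hand side; by the open mapping theorem and uniqueness the constant is the same on all
subintervals (`exists_repNorm_le_of_maximalRegularity`). Functions that vanish at the left endpoint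
have `X_p` norms bounded by their `E₁` norm, with constant one whatever the length of the interval
(`IsE1Rep.traceENorm_le_of_left_eq_zero`).

Inserting `f(ψ)` and `A(ψ)` splits `H` into a perturbation of size `ε` and terms that are a small
multiple of the size of `w`: on a short interval the `L^p` norms of the Lipschitz weight and of `φ`
in `X₁` are small, and `A'(ψ)` is close to `B`. These terms are absorbed, and `w` is controlled by
`ε` plus the initial difference (`Assumptions.exists_local_estimate`). Only Lipschitz constants of
the limit problem occur, so those of the approximating problems need not be uniform in `n`.

The estimate presupposes that `ψ` stays within `r` of `φ`. A continuity argument removes this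
condition (`IsMaximalSolution.bootstrap`): the estimate improves `r` to `r / 2`, and its `E₁` bound
prevents `ψ` from ceasing to exist. Indeed, a solution on a half-open interval with bounded `E₁`
norm extends to the endpoint, and from there a contraction argument with a frozen operator continues
it (`Assumptions.exists_local_solution`), against maximality. No uniqueness theorem for the
nonlinear equation is needed, since every extension is constructed to agree with the maximal
solution.

Finitely many short intervals cover a compact one, so convergence propagates from `t₀`
(`exists_propagation`, `Icc_induction`). The bound on the existence times then follows by exhausting
the limit interval. -/

namespace MaxReg

/-! ### `L^p` norms on intervals -/

section LpInterval

variable {E : Type*} [NormedAddCommGroup E] {p : ℝ≥0∞}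

theorem eLpNorm_restrict_union_le [hp : Fact (1 ≤ p)] {I J : Set ℝ} (hI : MeasurableSet I)
    (hJ : MeasurableSet J) {f : ℝ → E} (hfI : AEStronglyMeasurable f (volume.restrict I))
    (hfJ : AEStronglyMeasurable f (volume.restrict J)) :
    eLpNorm f p (volume.restrict (I ∪ J))
      ≤ eLpNorm f p (volume.restrict I) + eLpNorm f p (volume.restrict J) := by
  have hJI : MeasurableSet (J \ I) := hJ.diff hI
  have hm1 : AEStronglyMeasurable (I.indicator f) volume :=
    (aestronglyMeasurable_indicator_iff hI).2 hfI
  have hm2 : AEStronglyMeasurable ((J \ I).indicator f) volume :=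
    (aestronglyMeasurable_indicator_iff hJI).2
      (hfJ.mono_measure (Measure.restrict_mono sdiff_subset le_rfl))
  have heq : (I ∪ J).indicator f = I.indicator f + (J \ I).indicator f := by
    ext x
    by_cases h1 : x ∈ I <;> by_cases h2 : x ∈ J <;> simp [h1, h2]
  rw [← eLpNorm_indicator_eq_eLpNorm_restrict (f := f) (hI.union hJ), heq]
  refine (eLpNorm_add_le hm1 hm2 hp.out).trans ?_
  rw [eLpNorm_indicator_eq_eLpNorm_restrict hI, eLpNorm_indicator_eq_eLpNorm_restrict hJI]
  gcongr
  exact sdiff_subset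

theorem memLp_restrict_union [Fact (1 ≤ p)] {I J : Set ℝ} (hI : MeasurableSet I)
    (hJ : MeasurableSet J) {f : ℝ → E} (hfI : MemLp f p (volume.restrict I))
    (hfJ : MemLp f p (volume.restrict J)) : MemLp f p (volume.restrict (I ∪ J)) :=
  ⟨aestronglyMeasurable_union_iff.2 ⟨hfI.1, hfJ.1⟩,
    (eLpNorm_restrict_union_le hI hJ hfI.1 hfJ.1).trans_lt (ENNReal.add_lt_top.2 ⟨hfI.2, hfJ.2⟩)⟩

theorem memLp_restrict_mono {I J : Set ℝ} (h : J ⊆ I) {f : ℝ → E}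
    (hf : MemLp f p (volume.restrict I)) : MemLp f p (volume.restrict J) :=
  hf.mono_measure (Measure.restrict_mono h le_rfl)

theorem eLpNorm_restrict_mono {I J : Set ℝ} (h : J ⊆ I) (f : ℝ → E) :
    eLpNorm f p (volume.restrict J) ≤ eLpNorm f p (volume.restrict I) :=
  eLpNorm_mono_measure _ (Measure.restrict_mono h le_rfl)

/-- Absolute continuity of the `L^p` norm with respect to the length of the interval. -/
theorem exists_eLpNorm_Icc_le [hp : Fact (1 ≤ p)] (hp_top : p ≠ ∞) {I : Set ℝ} {f : ℝ → E}
    (hf : MemLp f p (volume.restrict I)) {ε : ℝ} (hε : 0 < ε) :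
    ∃ δ : ℝ, 0 < δ ∧ ∀ c d : ℝ, Icc c d ⊆ I → d - c ≤ δ →
      eLpNorm f p (volume.restrict (Icc c d)) ≤ ENNReal.ofReal ε := by
  obtain ⟨δ, hδ, h⟩ := hf.eLpNorm_indicator_le hp.out hp_top hε
  refine ⟨δ, hδ, fun c d hcd hle => ?_⟩
  have := h (Icc c d) measurableSet_Icc (by
    rw [Measure.restrict_apply measurableSet_Icc]
    refine (measure_mono inter_subset_left).trans ?_
    rw [Real.volume_Icc]
    exact ENNReal.ofReal_le_ofReal hle)
  rwa [eLpNorm_indicator_eq_eLpNorm_restrict measurableSet_Icc,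
    Measure.restrict_restrict measurableSet_Icc, inter_eq_left.2 hcd] at this

/-- Continuity of translations in `L^p`. -/
theorem tendsto_eLpNorm_translate_sub [Fact (1 ≤ p)] (hp_top : p ≠ ∞) {g : ℝ → E}
    (hg : MemLp g p volume) :
    Tendsto (fun h : ℝ => eLpNorm (fun t => g (t + h) - g t) p volume) (𝓝 0) (𝓝 0) := by
  let τ : ℝ → C(ℝ, ℝ) := fun h => ⟨fun t => t + h, by fun_prop⟩
  have hτ : Continuous τ := ContinuousMap.continuous_of_continuous_uncurry _ (by
    change Continuous fun x : ℝ × ℝ => x.2 + x.1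
    fun_prop)
  have hmp : ∀ h, MeasurePreserving (τ h) volume volume := fun h =>
    measurePreserving_add_right volume h
  have key := (Continuous.compMeasurePreservingLp (p := p) (f := fun _ : ℝ => hg.toLp g)
    continuous_const hτ hmp hp_top).tendsto 0
  have key2 := (tendsto_iff_edist_tendsto_0.1 key)
  refine key2.congr fun h => ?_
  rw [Lp.toLp_compMeasurePreserving, Lp.toLp_compMeasurePreserving, Lp.edist_toLp_toLp]
  refine congrArg (fun F => eLpNorm F p volume) ?_
  ext t
  simp [τ]

end LpInterval

section

variable {E F : Type*} [NormedAddCommGroup E] [NormedAddCommGroup F]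

/-- The `E₁(I)` norm computed from a given representative. -/
noncomputable def repNorm (p : ℝ≥0∞) (I : Set ℝ) (u du : ℝ → E) (v : ℝ → F) : ℝ≥0∞ :=
  eLpNorm u p (volume.restrict I) + eLpNorm du p (volume.restrict I)
    + eLpNorm v p (volume.restrict I)

theorem repNorm_mono (p : ℝ≥0∞) {I J : Set ℝ} (h : J ⊆ I) (u du : ℝ → E) (v : ℝ → F) :
    repNorm p J u du v ≤ repNorm p I u du v := by
  unfold repNorm
  gcongr

end

variable {X₀ X₁ : Type*} [NormedAddCommGroup X₀] [NormedSpace ℝ X₀]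
  [NormedAddCommGroup X₁] [NormedSpace ℝ X₁]

/-! ### Operations on representatives of elements of `E₁` -/

section Rep

variable {j : X₁ →L[ℝ] X₀} {p : ℝ≥0∞} {I J : Set ℝ} {u du u' du' : ℝ → X₀} {v v' : ℝ → X₁}

theorem e1Norm_le_repNorm (h : IsE1Rep j p I u du v) : e1Norm j p I u ≤ repNorm p I u du v :=
  e1Norm_le h

theorem exists_rep_of_e1Norm_lt {r : ℝ≥0∞} (h : e1Norm j p I u < r) :
    ∃ du v, IsE1Rep j p I u du v ∧ repNorm p I u du v < r := by
  simp only [e1Norm, iInf_lt_iff] at h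
  obtain ⟨du, v, h1, h2⟩ := h
  exact ⟨du, v, h1, h2⟩

theorem exists_rep_of_traceENorm_lt {x : X₀} {r : ℝ≥0∞} (h : traceENorm j p x < r) :
    ∃ F dF v, F 0 = x ∧ IsE1Rep j p (Ici (0 : ℝ)) F dF v ∧ repNorm p (Ici (0 : ℝ)) F dF v < r := by
  simp only [traceENorm, iInf_lt_iff] at h
  obtain ⟨F, hF, h1⟩ := h
  obtain ⟨dF, v, h2, h3⟩ := exists_rep_of_e1Norm_lt h1
  exact ⟨F, dF, v, hF, h2, h3⟩

namespace IsE1Rep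

theorem repNorm_lt_top (h : IsE1Rep j p I u du v) : repNorm p I u du v < ∞ :=
  ENNReal.add_lt_top.2 ⟨ENNReal.add_lt_top.2 ⟨h.memLp.2, h.memLp_deriv.2⟩, h.memLp_dom.2⟩

theorem singleton (a : ℝ) (u : ℝ → X₀) : IsE1Rep j p (Icc a a) u 0 0 where
  memLp := by simp [memLp_measure_zero]
  memLp_deriv := MemLp.zero
  memLp_dom := MemLp.zero
  sub_eq_integral s hs t ht := by
    rw [Icc_self, mem_singleton_iff] at hs ht
    simp [hs, ht]
  embed_ae_eq := by simp

theorem mono (h : IsE1Rep j p I u du v) (hJ : J ⊆ I) : IsE1Rep j p J u du v where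
  memLp := memLp_restrict_mono hJ h.memLp
  memLp_deriv := memLp_restrict_mono hJ h.memLp_deriv
  memLp_dom := memLp_restrict_mono hJ h.memLp_dom
  sub_eq_integral s hs t ht := h.sub_eq_integral s (hJ hs) t (hJ ht)
  embed_ae_eq := ae_restrict_of_ae_restrict_of_subset hJ h.embed_ae_eq

theorem sub [Fact (1 ≤ p)] [I.OrdConnected] (h : IsE1Rep j p I u du v)
    (h' : IsE1Rep j p I u' du' v') : IsE1Rep j p I (u - u') (du - du') (v - v') := by
  simpa [sub_eq_add_neg] using h.add (h'.smul (-1))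

theorem congr [hI : I.OrdConnected] (h : IsE1Rep j p I u du v) (hu : EqOn u u' I)
    (hdu : du =ᵐ[volume.restrict I] du') (hv : v =ᵐ[volume.restrict I] v') :
    IsE1Rep j p I u' du' v' where
  memLp := h.memLp.ae_eq (by
    filter_upwards [ae_restrict_mem hI.measurableSet] with t ht using hu ht)
  memLp_deriv := h.memLp_deriv.ae_eq hdu
  memLp_dom := h.memLp_dom.ae_eq hv
  sub_eq_integral s hs t ht := by
    rw [← hu hs, ← hu ht, h.sub_eq_integral s hs t ht]
    refine intervalIntegral.integral_congr_ae_restrict ?_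
    exact ae_restrict_of_ae_restrict_of_subset
      (uIoc_subset_uIcc.trans (hI.uIcc_subset hs ht)) hdu
  embed_ae_eq := by
    filter_upwards [ae_restrict_mem hI.measurableSet, hv, h.embed_ae_eq] with t ht h1 h2
    rw [← h1, h2, hu ht]

/-- The common point `c` excludes a jump: every increment of `u` splits at `c` into increments
inside `I` and inside `J`. -/
theorem glue [Fact (1 ≤ p)] [hI : I.OrdConnected] [hJ : J.OrdConnected] {c : ℝ}
    (hcI : c ∈ I) (hcJ : c ∈ J) (h : IsE1Rep j p I u du v) (h' : IsE1Rep j p J u du v) :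
    IsE1Rep j p (I ∪ J) u du v where
  memLp := memLp_restrict_union hI.measurableSet hJ.measurableSet h.memLp h'.memLp
  memLp_deriv :=
    memLp_restrict_union hI.measurableSet hJ.measurableSet h.memLp_deriv h'.memLp_deriv
  memLp_dom := memLp_restrict_union hI.measurableSet hJ.measurableSet h.memLp_dom h'.memLp_dom
  sub_eq_integral := by
    have key : ∀ s ∈ I ∪ J, u s - u c = ∫ r in c..s, du r ∧ IntervalIntegrable du volume c s := by
      rintro s (hs | hs)
      · exact ⟨h.sub_eq_integral c hcI s hs, h.intervalIntegrable hcI hs⟩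
      · exact ⟨h'.sub_eq_integral c hcJ s hs, h'.intervalIntegrable hcJ hs⟩
    intro s hs t ht
    rw [← intervalIntegral.integral_add_adjacent_intervals (key s hs).2.symm (key t ht).2,
      ← (key t ht).1, intervalIntegral.integral_symm, ← (key s hs).1]
    abel
  embed_ae_eq := (ae_restrict_union_iff _ _ _).2 ⟨h.embed_ae_eq, h'.embed_ae_eq⟩

theorem repNorm_union_le [Fact (1 ≤ p)] [hI : I.OrdConnected] [hJ : J.OrdConnected]
    (h : IsE1Rep j p I u du v) (h' : IsE1Rep j p J u du v) :
    repNorm p (I ∪ J) u du v ≤ repNorm p I u du v + repNorm p J u du v := by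
  unfold repNorm
  refine (add_le_add (add_le_add
    (eLpNorm_restrict_union_le hI.measurableSet hJ.measurableSet h.memLp.1 h'.memLp.1)
    (eLpNorm_restrict_union_le hI.measurableSet hJ.measurableSet h.memLp_deriv.1
      h'.memLp_deriv.1))
    (eLpNorm_restrict_union_le hI.measurableSet hJ.measurableSet h.memLp_dom.1
      h'.memLp_dom.1)).trans (le_of_eq ?_)
  ring

theorem translate [hI : I.OrdConnected] (h : IsE1Rep j p I u du v) (c : ℝ) :
    IsE1Rep j p ((fun t => t + c) ⁻¹' I) (fun t => u (t + c)) (fun t => du (t + c))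
      (fun t => v (t + c)) := by
  have hmp : MeasurePreserving (fun t : ℝ => t + c)
      (volume.restrict ((fun t => t + c) ⁻¹' I)) (volume.restrict I) :=
    (measurePreserving_add_right volume c).restrict_preimage hI.measurableSet
  exact
  { memLp := h.memLp.comp_measurePreserving hmp
    memLp_deriv := h.memLp_deriv.comp_measurePreserving hmp
    memLp_dom := h.memLp_dom.comp_measurePreserving hmp
    sub_eq_integral := fun s hs t ht => by
      rw [h.sub_eq_integral _ hs _ ht, intervalIntegral.integral_comp_add_right]
    embed_ae_eq := hmp.quasiMeasurePreserving.ae h.embed_ae_eq }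

theorem repNorm_translate [hI : I.OrdConnected] (h : IsE1Rep j p I u du v) (c : ℝ) :
    repNorm p ((fun t => t + c) ⁻¹' I) (fun t => u (t + c)) (fun t => du (t + c))
      (fun t => v (t + c)) = repNorm p I u du v := by
  have hmp : MeasurePreserving (fun t : ℝ => t + c)
      (volume.restrict ((fun t => t + c) ⁻¹' I)) (volume.restrict I) :=
    (measurePreserving_add_right volume c).restrict_preimage hI.measurableSet
  unfold repNorm
  rw [← eLpNorm_comp_measurePreserving h.memLp.1 hmp,
    ← eLpNorm_comp_measurePreserving h.memLp_deriv.1 hmp,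
    ← eLpNorm_comp_measurePreserving h.memLp_dom.1 hmp]
  rfl

/-- Time reversal transfers trace estimates from the right endpoint of an interval to the left one.
-/
theorem reflect [hI : I.OrdConnected] (h : IsE1Rep j p I u du v) :
    IsE1Rep j p ((fun t => -t) ⁻¹' I) (fun t => u (-t)) (fun t => - du (-t))
      (fun t => v (-t)) := by
  have hmp : MeasurePreserving (fun t : ℝ => -t)
      (volume.restrict ((fun t => -t) ⁻¹' I)) (volume.restrict I) :=
    (Measure.measurePreserving_neg volume).restrict_preimage hI.measurableSet
  exact
  { memLp := h.memLp.comp_measurePreserving hmp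
    memLp_deriv := (h.memLp_deriv.comp_measurePreserving hmp).neg
    memLp_dom := h.memLp_dom.comp_measurePreserving hmp
    sub_eq_integral := fun s hs t ht => by
      rw [h.sub_eq_integral _ hs _ ht, intervalIntegral.integral_neg,
        intervalIntegral.integral_comp_neg, ← intervalIntegral.integral_symm]
    embed_ae_eq := hmp.quasiMeasurePreserving.ae h.embed_ae_eq }

theorem repNorm_reflect [hI : I.OrdConnected] (h : IsE1Rep j p I u du v) :
    repNorm p ((fun t => -t) ⁻¹' I) (fun t => u (-t)) (fun t => - du (-t))
      (fun t => v (-t)) = repNorm p I u du v := by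
  have hmp : MeasurePreserving (fun t : ℝ => -t)
      (volume.restrict ((fun t => -t) ⁻¹' I)) (volume.restrict I) :=
    (Measure.measurePreserving_neg volume).restrict_preimage hI.measurableSet
  have : (fun t => - du (-t)) = -(du ∘ fun t => -t) := rfl
  unfold repNorm
  rw [← eLpNorm_comp_measurePreserving h.memLp.1 hmp, this, eLpNorm_neg,
    ← eLpNorm_comp_measurePreserving h.memLp_deriv.1 hmp,
    ← eLpNorm_comp_measurePreserving h.memLp_dom.1 hmp]
  rfl

/-- Extension by zero to a larger interval. -/
theorem indicator [hI : I.OrdConnected] [hJ : J.OrdConnected] [Fact (1 ≤ p)] {c : ℝ}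
    (hcI : c ∈ I) (hcJ : c ∈ J) (hIJ : I ∩ J ⊆ {c}) (hu : u c = 0)
    (h : IsE1Rep j p I u du v) :
    IsE1Rep j p (I ∪ J) (I.indicator u) (I.indicator du) (I.indicator v) ∧
    repNorm p (I ∪ J) (I.indicator u) (I.indicator du) (I.indicator v) = repNorm p I u du v := by
  have hsing : volume (I ∩ J) = 0 := measure_mono_null hIJ Real.volume_singleton
  have haeJ : ∀ᵐ t ∂(volume.restrict J), t ∉ I := by
    rw [ae_restrict_iff' hJ.measurableSet, ae_iff]
    refine measure_mono_null ?_ hsing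
    intro t ht
    simp only [Classical.not_imp, not_not, mem_ofPred_eq] at ht
    exact ⟨ht.2, ht.1⟩
  have h1 : IsE1Rep j p I (I.indicator u) (I.indicator du) (I.indicator v) :=
    h.congr (fun t ht => (indicator_of_mem ht u).symm)
      ((indicator_ae_eq_restrict hI.measurableSet).symm)
      ((indicator_ae_eq_restrict hI.measurableSet).symm)
  have h2 : IsE1Rep j p J (I.indicator u) (I.indicator du) (I.indicator v) := by
    refine IsE1Rep.zero.congr ?_ ?_ ?_
    · intro t ht
      by_cases htI : t ∈ I
      · rw [indicator_of_mem htI, mem_singleton_iff.1 (hIJ ⟨htI, ht⟩), hu]; rfl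
      · rw [indicator_of_notMem htI]; rfl
    · filter_upwards [haeJ] with t ht
      rw [indicator_of_notMem ht]; rfl
    · filter_upwards [haeJ] with t ht
      rw [indicator_of_notMem ht]; rfl
  refine ⟨h1.glue hcI hcJ h2, ?_⟩
  unfold repNorm
  simp only [eLpNorm_indicator_eq_eLpNorm_restrict hI.measurableSet,
    Measure.restrict_restrict hI.measurableSet, inter_eq_left.2 subset_union_left]

end IsE1Rep

end Rep

end MaxReg

/-! ### Translations and shrinking intervals in `L^p` -/

namespace MaxReg

/-- Extend `g` by zero to the line. Since the shift `t - a` is nonnegative, it maps `[a, ∞)` into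
itself, so the extension and `g` give the same differences there. -/
theorem tendsto_eLpNorm_translate_sub_Ici {E : Type*} [NormedAddCommGroup E] {p : ℝ≥0∞}
    [Fact (1 ≤ p)] (hp_top : p ≠ ∞) {a : ℝ} {g : ℝ → E} (hg : MemLp g p (volume.restrict (Ici a))) :
    Tendsto (fun t => eLpNorm (fun r => g (r + (t - a)) - g r) p (volume.restrict (Ici a)))
      (𝓝[≥] a) (𝓝 0) := by
  have hg' : MemLp ((Ici a).indicator g) p volume :=
    (memLp_indicator_iff_restrict measurableSet_Ici).2 hg
  have h1 := tendsto_eLpNorm_translate_sub hp_top hg'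
  have h2 : Tendsto (fun t : ℝ => t - a) (𝓝[≥] a) (𝓝 0) :=
    ((continuous_id.sub continuous_const).tendsto' a 0 (by simp)).mono_left nhdsWithin_le_nhds
  refine tendsto_of_tendsto_of_tendsto_of_le_of_le' tendsto_const_nhds (h1.comp h2)
    (Eventually.of_forall fun _ => zero_le) ?_
  filter_upwards [self_mem_nhdsWithin] with t ht
  refine le_trans (le_of_eq ?_)
    (eLpNorm_mono_measure _ (Measure.restrict_le_self (s := Ici a)))
  refine eLpNorm_congr_ae ?_
  filter_upwards [ae_restrict_mem measurableSet_Ici] with r hr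
  have hr' : r + (t - a) ∈ Ici a := by
    simp only [mem_Ici] at hr ht ⊢; linarith
  rw [indicator_of_mem hr', indicator_of_mem hr]

theorem tendsto_eLpNorm_Icc {E : Type*} [NormedAddCommGroup E] {p : ℝ≥0∞}
    [Fact (1 ≤ p)] (hp_top : p ≠ ∞) {a b : ℝ} {g : ℝ → E}
    (hg : MemLp g p (volume.restrict (Icc a b))) :
    Tendsto (fun t => eLpNorm g p (volume.restrict (Icc a t))) (𝓝[Icc a b] a) (𝓝 0) := by
  rw [ENNReal.tendsto_nhds_zero]
  intro ε hε
  obtain ⟨ε', hε', hle⟩ : ∃ ε' : ℝ, 0 < ε' ∧ ENNReal.ofReal ε' ≤ ε := by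
    rcases eq_or_ne ε ∞ with rfl | hne
    · exact ⟨1, one_pos, le_top⟩
    · exact ⟨ε.toReal, ENNReal.toReal_pos hε.ne' hne, (ENNReal.ofReal_toReal hne).le⟩
  obtain ⟨δ, hδ, hh⟩ := exists_eLpNorm_Icc_le hp_top hg hε'
  filter_upwards [self_mem_nhdsWithin,
    mem_nhdsWithin_of_mem_nhds (Iio_mem_nhds (show a < a + δ by linarith))] with t ht htδ
  refine (hh a t (Icc_subset_Icc_right ht.2) ?_).trans hle
  simp only [mem_Iio] at htδ; linarith

variable {X₀ X₁ : Type*} [NormedAddCommGroup X₀] [NormedSpace ℝ X₀]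
  [NormedAddCommGroup X₁] [NormedSpace ℝ X₁]

/-! ### Traces of `E₁` functions -/

section Traces

variable {j : X₁ →L[ℝ] X₀} {p : ℝ≥0∞} {a b : ℝ} {u du : ℝ → X₀} {v : ℝ → X₁}

/-- The restriction of `u` to `[t, ∞)`, shifted to start at `0`, is a competitor in the infimum
defining the trace norm of `u t`. -/
theorem IsE1Rep.traceENorm_le_repNorm_Ici {a t : ℝ} (h : IsE1Rep j p (Ici a) u du v)
    (ht : a ≤ t) : traceENorm j p (u t) ≤ repNorm p (Ici a) u du v := by
  have hpre : (fun r : ℝ => r + t) ⁻¹' (Ici t) = Ici 0 := by ext r; simp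
  have h1 := h.mono (Ici_subset_Ici.2 ht)
  have h2 := h1.translate t
  have h3 := h1.repNorm_translate t
  rw [hpre] at h2 h3
  refine (traceENorm_le (F := fun r => u (r + t)) (by simp)).trans ?_
  exact (e1Norm_le_repNorm h2).trans (h3.le.trans (repNorm_mono p (Ici_subset_Ici.2 ht) _ _ _))

theorem IsE1Rep.shift_Ici (h : IsE1Rep j p (Ici 0) u du v) (s : ℝ) :
    IsE1Rep j p (Ici s) (fun t => u (t - s)) (fun t => du (t - s)) (fun t => v (t - s)) ∧
    repNorm p (Ici s) (fun t => u (t - s)) (fun t => du (t - s)) (fun t => v (t - s))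
      = repNorm p (Ici 0) u du v := by
  have hpre : (fun r : ℝ => r + (-s)) ⁻¹' (Ici 0) = Ici s := by ext r; simp
  have h2 := h.translate (-s)
  have h3 := h.repNorm_translate (-s)
  rw [hpre] at h2 h3
  exact ⟨h2, h3⟩

/-- Every element of `X_p` is the value at `s` of a function in `E₁([s, ∞))` whose norm is almost
the norm of that element. -/
theorem exists_extension {x : X₀} {r : ℝ≥0∞} (h : traceENorm j p x < r) (s : ℝ) :
    ∃ F dF v, F s = x ∧ IsE1Rep j p (Ici s) F dF v ∧ repNorm p (Ici s) F dF v < r := by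
  obtain ⟨F, dF, v, h1, h2, h3⟩ := exists_rep_of_traceENorm_lt h
  obtain ⟨h4, h5⟩ := h2.shift_Ici s
  exact ⟨_, _, _, by simpa using h1, h4, h5 ▸ h3⟩

variable [Fact (1 ≤ p)]

/-- Vanishing at `b` allows extension by zero to the half-line at no cost in norm. Hence the
constant is one, independently of the length of the interval. -/
theorem IsE1Rep.traceENorm_le_of_right_eq_zero (h : IsE1Rep j p (Icc a b) u du v)
    (hb : u b = 0) {t : ℝ} (ht : t ∈ Icc a b) :
    traceENorm j p (u t) ≤ repNorm p (Icc a b) u du v := by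
  have hsub : Icc t b ⊆ Icc a b := Icc_subset_Icc_left ht.1
  obtain ⟨h1, h2⟩ := (h.mono hsub).indicator (J := Ici b) (c := b) (right_mem_Icc.2 ht.2) self_mem_Ici
    (fun x hx => le_antisymm hx.1.2 hx.2) hb
  rw [Icc_union_Ici_eq_Ici ht.2] at h1 h2
  have h3 := h1.traceENorm_le_repNorm_Ici le_rfl
  rw [indicator_of_mem (show t ∈ Icc t b from ⟨le_rfl, ht.2⟩), h2] at h3
  exact h3.trans (repNorm_mono p hsub _ _ _)

theorem IsE1Rep.traceENorm_le_of_left_eq_zero (h : IsE1Rep j p (Icc a b) u du v)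
    (ha : u a = 0) {t : ℝ} (ht : t ∈ Icc a b) :
    traceENorm j p (u t) ≤ repNorm p (Icc a b) u du v := by
  have hpre : (fun r : ℝ => -r) ⁻¹' (Icc a b) = Icc (-b) (-a) := by ext r; simp [and_comm]
  have h1 := h.reflect
  have h2 := h.repNorm_reflect
  rw [hpre] at h1 h2
  have h3 := h1.traceENorm_le_of_right_eq_zero (by simpa using ha) (t := -t)
    ⟨neg_le_neg ht.2, neg_le_neg ht.1⟩
  rwa [h2, neg_neg] at h3

/-- The function `u(· + (t - a)) - u` has the value `u t - u a` at `a`, and its `E₁` norm tends to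
zero because translations are continuous in `L^p`. -/
theorem IsE1Rep.tendsto_traceENorm_Ici (hp_top : p ≠ ∞) (h : IsE1Rep j p (Ici a) u du v) :
    Tendsto (fun t => traceENorm j p (u t - u a)) (𝓝[≥] a) (𝓝 0) := by
  have hsum := ((tendsto_eLpNorm_translate_sub_Ici hp_top h.memLp).add (tendsto_eLpNorm_translate_sub_Ici hp_top h.memLp_deriv)).add
    (tendsto_eLpNorm_translate_sub_Ici hp_top h.memLp_dom)
  simp only [add_zero] at hsum
  refine tendsto_of_tendsto_of_tendsto_of_le_of_le' tendsto_const_nhds hsum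
    (Eventually.of_forall fun _ => zero_le) ?_
  filter_upwards [self_mem_nhdsWithin] with t ht
  have hsub : Ici a ⊆ (fun r : ℝ => r + (t - a)) ⁻¹' (Ici a) := by
    intro r hr; simp only [mem_Ici, mem_preimage] at hr ht ⊢; linarith
  have h1 := ((h.translate (t - a)).mono hsub).sub h
  have h2 := h1.traceENorm_le_repNorm_Ici le_rfl
  rw [Pi.sub_apply, add_sub_cancel] at h2
  exact h2

/-- Subtract an extension `F` of `u a`: the remainder vanishes at `a`, and `F` has finite traces
everywhere. The continuity statement at the left endpoint below rests on the same splitting. -/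
theorem IsE1Rep.traceENorm_lt_top (h : IsE1Rep j p (Icc a b) u du v)
    (ha : traceENorm j p (u a) < ∞) {t : ℝ} (ht : t ∈ Icc a b) : traceENorm j p (u t) < ∞ := by
  obtain ⟨F, dF, w, h1, h2, h3⟩ := exists_extension ha a
  have h4 := h.sub (h2.mono (Icc_subset_Ici_self))
  have h5 := h4.traceENorm_le_of_left_eq_zero (by simp [h1]) ht
  have h6 := h2.traceENorm_le_repNorm_Ici ht.1
  have h7 := traceENorm_add_le (j := j) (p := p) ((u - F) t) (F t)
  rw [Pi.sub_apply, sub_add_cancel] at h7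
  exact h7.trans_lt (ENNReal.add_lt_top.2 ⟨h5.trans_lt h4.repNorm_lt_top, h6.trans_lt h3⟩)

theorem tendsto_repNorm_Icc (hp_top : p ≠ ∞) (h : IsE1Rep j p (Icc a b) u du v) :
    Tendsto (fun t => repNorm p (Icc a t) u du v) (𝓝[Icc a b] a) (𝓝 0) := by
  have hsum := ((tendsto_eLpNorm_Icc hp_top h.memLp).add (tendsto_eLpNorm_Icc hp_top h.memLp_deriv)).add
    (tendsto_eLpNorm_Icc hp_top h.memLp_dom)
  rw [add_zero, add_zero] at hsum
  exact hsum

theorem IsE1Rep.tendsto_traceENorm_left (hp_top : p ≠ ∞) (h : IsE1Rep j p (Icc a b) u du v)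
    (ha : traceENorm j p (u a) < ∞) :
    Tendsto (fun t => traceENorm j p (u t - u a)) (𝓝[Icc a b] a) (𝓝 0) := by
  obtain ⟨F, dF, w, h1, h2, -⟩ := exists_extension ha a
  have h4 := h.sub (h2.mono (J := Icc a b) fun _ hx => hx.1)
  have h5 := tendsto_repNorm_Icc hp_top h4
  have h6 := (h2.tendsto_traceENorm_Ici hp_top).mono_left
    (nhdsWithin_mono a (s := Icc a b) fun _ hx => hx.1)
  have h7 := h5.add h6
  rw [add_zero] at h7
  refine tendsto_of_tendsto_of_tendsto_of_le_of_le' tendsto_const_nhds h7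
    (Eventually.of_forall fun _ => zero_le) ?_
  filter_upwards [self_mem_nhdsWithin] with t ht
  have h8 := (h4.mono (Icc_subset_Icc_right ht.2)).traceENorm_le_of_left_eq_zero
    (by simp [h1]) (t := t) ⟨ht.1, le_rfl⟩
  have h9 := traceENorm_add_le (j := j) (p := p) ((u - F) t) (F t - F a)
  rw [Pi.sub_apply, sub_add_sub_cancel, h1] at h9
  rw [h1]
  exact h9.trans (add_le_add h8 le_rfl)

end Traces

/-! ### Curves in `X_p` -/

namespace Xp

variable {j : X₁ →L[ℝ] X₀} {p : ℝ≥0∞} [Fact (1 ≤ p)]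

theorem enorm_eq (x : Xp j p) : ‖x‖ₑ = traceENorm j p (toX₀ x) := by
  rw [← ofReal_norm, norm_def, ENNReal.ofReal_toReal x.traceENorm_lt_top.ne]

theorem edist_eq (x y : Xp j p) : edist x y = traceENorm j p (toX₀ x - toX₀ y) := by
  rw [edist_eq_enorm_sub, enorm_eq, map_sub]

/-- The element of `X_p` given by an element of `X₀` with finite trace norm, and `0` for the other
elements of `X₀`. -/
noncomputable def ofX₀ (j : X₁ →L[ℝ] X₀) (p : ℝ≥0∞) [Fact (1 ≤ p)] (x : X₀) : Xp j p :=
  open Classical in if h : traceENorm j p x < ∞ then ⟨x, h⟩ else 0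

theorem toX₀_ofX₀ {x : X₀} (h : traceENorm j p x < ∞) : toX₀ (ofX₀ j p x) = x := by
  have : ofX₀ j p x = ⟨x, h⟩ := dif_pos h
  rw [this]; rfl

theorem ofX₀_toX₀ (x : Xp j p) : ofX₀ j p (toX₀ x) = x :=
  toX₀_injective (toX₀_ofX₀ x.traceENorm_lt_top)

end Xp

/-- An `E₁` function is continuous with values in `X_p`. -/
theorem IsE1Rep.continuousOn_Xp {j : X₁ →L[ℝ] X₀} {p : ℝ≥0∞} [Fact (1 ≤ p)] (hp_top : p ≠ ∞)
    {a b : ℝ} {φ : ℝ → Xp j p} {du : ℝ → X₀} {v : ℝ → X₁}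
    (h : IsE1Rep j p (Icc a b) (fun t => (φ t).toX₀) du v) : ContinuousOn φ (Icc a b) := by
  intro s hs
  have hR : ContinuousWithinAt φ (Icc s b) s := by
    rw [ContinuousWithinAt, tendsto_iff_edist_tendsto_0]
    simp only [Xp.edist_eq]
    exact (h.mono (Icc_subset_Icc_left hs.1)).tendsto_traceENorm_left hp_top
      (φ s).traceENorm_lt_top
  -- Continuity from the left is continuity from the right of the time-reversed function.
  have hL : ContinuousWithinAt φ (Icc a s) s := by
    have hpre : (fun r : ℝ => -r) ⁻¹' (Icc a s) = Icc (-s) (-a) := by ext r; simp [and_comm]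
    have h1 := (h.mono (Icc_subset_Icc_right hs.2)).reflect
    rw [hpre] at h1
    have h2 := h1.tendsto_traceENorm_left hp_top (by simpa using (φ s).traceENorm_lt_top)
    have h3 : Tendsto (fun t : ℝ => -t) (𝓝[Icc a s] s) (𝓝[Icc (-s) (-a)] (-s)) := by
      refine (continuous_neg.tendsto s).inf ?_
      rw [tendsto_principal_principal]
      exact fun r hr => ⟨neg_le_neg hr.2, neg_le_neg hr.1⟩
    rw [ContinuousWithinAt, tendsto_iff_edist_tendsto_0]
    simp only [Xp.edist_eq]
    refine (h2.comp h3).congr fun t => ?_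
    simp
  have := hL.union hR
  rwa [Icc_union_Icc_eq_Icc hs.1 hs.2] at this

end MaxReg

namespace MaxReg

/-! ### Integration from the left endpoint as an operator on `L^p` -/

section Primitive

theorem intervalIntegrable_of_memLp {E : Type*} [NormedAddCommGroup E] {p : ℝ≥0∞}
    [hp : Fact (1 ≤ p)] {c d : ℝ} {g : ℝ → E}
    (hg : MemLp g p (volume.restrict (Icc c d))) {s t : ℝ} (hs : s ∈ Icc c d)
    (ht : t ∈ Icc c d) : IntervalIntegrable g volume s t := by
  rw [intervalIntegrable_iff]
  have h1 := hg.integrable hp.out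
  exact h1.mono_measure (Measure.restrict_mono
    (uIoc_subset_uIcc.trans (ordConnected_Icc.uIcc_subset hs ht)) le_rfl)

variable {E : Type*} [NormedAddCommGroup E] [NormedSpace ℝ E] {p : ℝ≥0∞} {c d : ℝ}

theorem enorm_primitive_le {g : ℝ → E} {t : ℝ} (ht : t ∈ Icc c d) :
    ‖∫ r in c..t, g r‖ₑ ≤ eLpNorm g 1 (volume.restrict (Icc c d)) := by
  rw [intervalIntegral.integral_of_le ht.1, eLpNorm_one_eq_lintegral_enorm]
  refine (enorm_integral_le_lintegral_enorm _).trans ?_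
  have hsub : Ioc c t ⊆ Icc c d := fun x hx => ⟨hx.1.le, hx.2.trans ht.2⟩
  exact lintegral_mono' (Measure.restrict_mono hsub le_rfl) le_rfl

/-- The primitive is bounded pointwise by the `L¹` norm of `g`, and on a finite interval this is
bounded by the `L^p` norm. -/
theorem exists_eLpNorm_primitive_le [hp : Fact (1 ≤ p)] (c d : ℝ) :
    ∃ K : ℝ≥0∞, K < ∞ ∧ ∀ g : ℝ → E, MemLp g p (volume.restrict (Icc c d)) →
      eLpNorm (fun t => ∫ r in c..t, g r) p (volume.restrict (Icc c d))
        ≤ K * eLpNorm g p (volume.restrict (Icc c d)) := by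
  set μ := volume.restrict (Icc c d) with hμ
  have hp' := hp.out
  have hne : ∀ r : ℝ, 0 ≤ r → μ univ ^ r < ∞ := fun r hr =>
    ENNReal.rpow_lt_top_of_nonneg hr (measure_ne_top μ univ)
  have hexp : 0 ≤ 1 / (1 : ℝ≥0∞).toReal - 1 / p.toReal := by
    rcases eq_or_ne p ∞ with rfl | htop
    · simp
    have : 1 ≤ p.toReal := by
      have := ENNReal.toReal_mono htop hp'
      simpa using this
    simp only [ENNReal.toReal_one, one_div, inv_one, sub_nonneg]
    exact inv_le_one_of_one_le₀ this
  refine ⟨μ univ ^ (1 / (1 : ℝ≥0∞).toReal - 1 / p.toReal) * μ univ ^ p.toReal⁻¹,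
    ENNReal.mul_lt_top (hne _ hexp) (hne _ (inv_nonneg.2 ENNReal.toReal_nonneg)), ?_⟩
  intro g hg
  have h1 : eLpNorm (fun t => ∫ r in c..t, g r) p μ ≤ eLpNorm g 1 μ • μ univ ^ p.toReal⁻¹ := by
    refine eLpNorm_le_of_ae_enorm_bound ?_
    filter_upwards [ae_restrict_mem measurableSet_Icc] with t ht using enorm_primitive_le ht
  refine h1.trans ?_
  have h2 := eLpNorm_le_eLpNorm_mul_rpow_measure_univ hp' hg.1
  rw [smul_eq_mul]
  refine (mul_le_mul_left h2 _).trans (le_of_eq ?_)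
  ring

theorem memLp_primitive [hp : Fact (1 ≤ p)] {g : ℝ → E}
    (hg : MemLp g p (volume.restrict (Icc c d))) :
    MemLp (fun t => ∫ r in c..t, g r) p (volume.restrict (Icc c d)) := by
  obtain ⟨K, hK, h⟩ := exists_eLpNorm_primitive_le (E := E) (p := p) c d
  refine ⟨?_, (h g hg).trans_lt (ENNReal.mul_lt_top hK hg.2)⟩
  rcases lt_or_ge d c with hlt | hle
  · simp [Icc_eq_empty (not_le.2 hlt)]
  have hint : IntegrableOn g (uIcc c d) := by
    rw [uIcc_of_le hle]
    exact hg.integrable hp.out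
  have := intervalIntegral.continuousOn_primitive_interval hint
  rw [uIcc_of_le hle] at this
  exact this.aestronglyMeasurable measurableSet_Icc

/-- The operator `g ↦ ∫_c^t g` on `L^p([c, d]; E)`. -/
noncomputable def primitiveL (E : Type*) [NormedAddCommGroup E] [NormedSpace ℝ E] (p : ℝ≥0∞)
    [Fact (1 ≤ p)] (c d : ℝ) :
    Lp E p (volume.restrict (Icc c d)) →L[ℝ] Lp E p (volume.restrict (Icc c d)) :=
  LinearMap.mkContinuousOfExistsBound
    { toFun := fun g => (memLp_primitive (Lp.memLp g)).toLp _
      map_add' := fun g h => by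
        rw [← MemLp.toLp_add]
        refine (MemLp.toLp_eq_toLp_iff _ _).2 ?_
        filter_upwards [ae_restrict_mem measurableSet_Icc] with t ht
        have hc : c ∈ Icc c d := ⟨le_rfl, ht.1.trans ht.2⟩
        rw [Pi.add_apply, ← intervalIntegral.integral_add
          (intervalIntegrable_of_memLp (Lp.memLp g) hc ht)
          (intervalIntegrable_of_memLp (Lp.memLp h) hc ht)]
        refine intervalIntegral.integral_congr_ae_restrict ?_
        exact ae_restrict_of_ae_restrict_of_subset
          (uIoc_subset_uIcc.trans (ordConnected_Icc.uIcc_subset hc ht)) (Lp.coeFn_add g h)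
      map_smul' := fun k g => by
        rw [RingHom.id_apply, ← MemLp.toLp_const_smul]
        refine (MemLp.toLp_eq_toLp_iff _ _).2 ?_
        filter_upwards [ae_restrict_mem measurableSet_Icc] with t ht
        have hc : c ∈ Icc c d := ⟨le_rfl, ht.1.trans ht.2⟩
        rw [Pi.smul_apply, ← intervalIntegral.integral_smul]
        refine intervalIntegral.integral_congr_ae_restrict ?_
        exact ae_restrict_of_ae_restrict_of_subset
          (uIoc_subset_uIcc.trans (ordConnected_Icc.uIcc_subset hc ht)) (Lp.coeFn_smul k g) }
    (by
      obtain ⟨K, hK, h⟩ := exists_eLpNorm_primitive_le (E := E) (p := p) c d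
      refine ⟨K.toReal, fun g => ?_⟩
      simp only [LinearMap.coe_mk, AddHom.coe_mk, Lp.norm_toLp]
      rw [Lp.norm_def, ← ENNReal.toReal_mul]
      exact ENNReal.toReal_mono (ENNReal.mul_lt_top hK (Lp.memLp g).2).ne (h g (Lp.memLp g)))

theorem coeFn_primitiveL [Fact (1 ≤ p)] (g : Lp E p (volume.restrict (Icc c d))) :
    primitiveL E p c d g =ᵐ[volume.restrict (Icc c d)] fun t => ∫ r in c..t, g r :=
  MemLp.coeFn_toLp (memLp_primitive (Lp.memLp g))

end Primitive

/-! ### A priori estimates from maximal regularity -/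

section LinearEstimates

variable {X₀ X₁ : Type*} [NormedAddCommGroup X₀] [NormedSpace ℝ X₀]
  [NormedAddCommGroup X₁] [NormedSpace ℝ X₁]
  {j : X₁ →L[ℝ] X₀} {p : ℝ≥0∞} {B : X₁ →L[ℝ] X₀}

theorem IsE1Rep.ae_eq_dom (hj : Function.Injective j) {I : Set ℝ} [hI : I.OrdConnected]
    {u du u' du' : ℝ → X₀} {v v' : ℝ → X₁} (h : IsE1Rep j p I u du v)
    (h' : IsE1Rep j p I u' du' v') (heq : EqOn u u' I) : v =ᵐ[volume.restrict I] v' := by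
  filter_upwards [h.embed_ae_eq, h'.embed_ae_eq, ae_restrict_mem hI.measurableSet]
    with t h1 h2 h3
  exact hj (by rw [h1, h2, heq h3])

theorem IsE1Rep.eLpNorm_le_mul_dom {I : Set ℝ} {u du : ℝ → X₀} {v : ℝ → X₁}
    (h : IsE1Rep j p I u du v) :
    eLpNorm u p (volume.restrict I) ≤ ‖j‖₊ * eLpNorm v p (volume.restrict I) := by
  refine eLpNorm_le_mul_eLpNorm_of_ae_le_mul' ?_ p
  filter_upwards [h.embed_ae_eq] with t ht
  rw [← ht]
  exact j.le_opENorm (v t)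

variable [Fact (1 ≤ p)]

/-- Open mapping theorem. A solution with zero initial value is a pair `(du, v)` of `L^p` functions
for which `j v` is the primitive of `du`; such pairs form a closed subspace `Γ`. The bounded map
`(du, v) ↦ du + B v` from `Γ` to `L^p` is surjective by the existence part of maximal regularity, so
preimages can be chosen with norm at most a constant times that of `g`. -/
theorem HasMaximalRegularity.exists_solution_le [CompleteSpace X₀] [CompleteSpace X₁] {c d : ℝ}
    (hcd : c ≤ d) (hB : HasMaximalRegularity j p B c d) :
    ∃ C : NNReal, ∀ g : ℝ → X₀, MemLp g p (volume.restrict (Icc c d)) →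
      ∃ u du v, u c = 0 ∧ IsE1Rep j p (Icc c d) u du v ∧
        (∀ᵐ t ∂(volume.restrict (Icc c d)), du t + B (v t) = g t) ∧
        eLpNorm du p (volume.restrict (Icc c d)) ≤ C * eLpNorm g p (volume.restrict (Icc c d)) ∧
        eLpNorm v p (volume.restrict (Icc c d)) ≤ C * eLpNorm g p (volume.restrict (Icc c d)) := by
  set μ := volume.restrict (Icc c d) with hμ
  let D : (Lp X₀ p μ × Lp X₁ p μ) →L[ℝ] Lp X₀ p μ :=
    (j.compLpL p μ).comp (ContinuousLinearMap.snd ℝ _ _)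
      - (primitiveL X₀ p c d).comp (ContinuousLinearMap.fst ℝ _ _)
  let S : (Lp X₀ p μ × Lp X₁ p μ) →L[ℝ] Lp X₀ p μ :=
    ContinuousLinearMap.fst ℝ _ _ + (B.compLpL p μ).comp (ContinuousLinearMap.snd ℝ _ _)
  let Γ : Submodule ℝ (Lp X₀ p μ × Lp X₁ p μ) := LinearMap.ker D.toLinearMap
  have hΓ : IsClosed (Γ : Set (Lp X₀ p μ × Lp X₁ p μ)) := D.isClosed_ker
  have : CompleteSpace Γ := hΓ.completeSpace_coe
  let S' : Γ →L[ℝ] Lp X₀ p μ := S.comp Γ.subtypeL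
  have hsurj : Function.Surjective S' := by
    intro g
    obtain ⟨⟨u, hu0, du, v, hrep, heq⟩, -⟩ := hB g (Lp.memLp g)
    have hmem : (hrep.memLp_deriv.toLp du, hrep.memLp_dom.toLp v) ∈ Γ := by
      change j.compLpL p μ (hrep.memLp_dom.toLp v)
        - primitiveL X₀ p c d (hrep.memLp_deriv.toLp du) = 0
      rw [sub_eq_zero]
      refine Lp.ext ?_
      filter_upwards [j.coeFn_compLpL (hrep.memLp_dom.toLp v), hrep.memLp_dom.coeFn_toLp,
        coeFn_primitiveL (hrep.memLp_deriv.toLp du), hrep.embed_ae_eq,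
        ae_restrict_mem measurableSet_Icc] with t h1 h2 h3 h4 h5
      have hc : c ∈ Icc c d := ⟨le_rfl, hcd⟩
      rw [h1, h2, h3, h4, ← sub_zero (u t), ← hu0, hrep.sub_eq_integral c hc t h5]
      refine intervalIntegral.integral_congr_ae_restrict ?_
      exact ae_restrict_of_ae_restrict_of_subset
          (uIoc_subset_uIcc.trans (ordConnected_Icc.uIcc_subset hc h5))
          hrep.memLp_deriv.coeFn_toLp.symm
    refine ⟨⟨_, hmem⟩, ?_⟩
    change hrep.memLp_deriv.toLp du + B.compLpL p μ (hrep.memLp_dom.toLp v) = g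
    refine Lp.ext ?_
    filter_upwards [Lp.coeFn_add (hrep.memLp_deriv.toLp du)
        (B.compLpL p μ (hrep.memLp_dom.toLp v)),
      B.coeFn_compLpL (hrep.memLp_dom.toLp v), hrep.memLp_dom.coeFn_toLp,
      hrep.memLp_deriv.coeFn_toLp, heq] with t h1 h2 h3 h4 h5
    rw [h1, Pi.add_apply, h2, h3, h4, h5]
  obtain ⟨C, hC0, hC⟩ := S'.exists_preimage_norm_le hsurj
  refine ⟨C.toNNReal, fun g hg => ?_⟩
  obtain ⟨⟨⟨du, v⟩, hx⟩, hSx, hle⟩ := hC (hg.toLp g)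
  have hprim : j.compLpL p μ v = primitiveL X₀ p c d du := sub_eq_zero.1 hx
  have hS : du + B.compLpL p μ v = hg.toLp g := hSx
  have hle' : ‖(du, v)‖ₑ ≤ C.toNNReal * eLpNorm g p μ := by
    rw [← Lp.enorm_toLp hg, ← ofReal_norm, ← ofReal_norm]
    change ENNReal.ofReal ‖(du, v)‖ ≤ ENNReal.ofReal C * _
    rw [← ENNReal.ofReal_mul hC0.le]
    exact ENNReal.ofReal_le_ofReal hle
  refine ⟨fun t => ∫ r in c..t, du r, du, v, by simp, ?_, ?_, ?_, ?_⟩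
  · exact
    { memLp := memLp_primitive (Lp.memLp du)
      memLp_deriv := Lp.memLp du
      memLp_dom := Lp.memLp v
      sub_eq_integral := fun s hs t ht => by
        have hc : c ∈ Icc c d := ⟨le_rfl, hcd⟩
        exact intervalIntegral.integral_interval_sub_left
          (intervalIntegrable_of_memLp (Lp.memLp du) hc ht)
          (intervalIntegrable_of_memLp (Lp.memLp du) hc hs)
      embed_ae_eq := by
        filter_upwards [j.coeFn_compLpL v, coeFn_primitiveL du] with t h1 h2
        rw [← h1, ← h2, hprim] }
  · filter_upwards [Lp.coeFn_add du (B.compLpL p μ v), B.coeFn_compLpL v, hg.coeFn_toLp]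
      with t h1 h2 h3
    rw [← h3, ← hS, h1, Pi.add_apply, h2]
  · refine le_trans ?_ hle'
    rw [← Lp.enorm_def, ← ofReal_norm, ← ofReal_norm]
    exact ENNReal.ofReal_le_ofReal (le_max_left _ _)
  · refine le_trans ?_ hle'
    rw [← Lp.enorm_def, ← ofReal_norm, ← ofReal_norm]
    exact ENNReal.ofReal_le_ofReal (le_max_right _ _)

/-- The `E₁` norm of a solution with zero initial value is bounded by the norm of the right-hand
side, with a constant that is the same for all subintervals of a compact interval. -/
theorem exists_repNorm_le_of_maximalRegularity [CompleteSpace X₀] [CompleteSpace X₁]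
    (hj : Function.Injective j) {c d : ℝ} (hcd : c < d)
    (hB : ∀ b, c < b → HasMaximalRegularity j p B c b) :
    ∃ C : NNReal, ∀ a b : ℝ, c ≤ a → a ≤ b → b ≤ d → ∀ (u du : ℝ → X₀) (v : ℝ → X₁),
      IsE1Rep j p (Icc a b) u du v → u a = 0 →
      repNorm p (Icc a b) u du v
        ≤ C * eLpNorm (fun t => du t + B (v t)) p (volume.restrict (Icc a b)) := by
  obtain ⟨C, hC⟩ := (hB d hcd).exists_solution_le hcd.le
  -- `du` and `v` contribute `C` each; `u = j v` contributes `‖j‖ * C`.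
  refine ⟨(‖j‖₊ + 2) * C, fun a b hca hab hbd u du v h hu => ?_⟩
  rcases hab.eq_or_lt with rfl | hab'
  · simp [repNorm]
  set g : ℝ → X₀ := fun t => du t + B (v t) with hg
  have hgm : MemLp g p (volume.restrict (Icc a b)) :=
    h.memLp_deriv.add (B.comp_memLp' h.memLp_dom)
  have hsub : Icc a b ⊆ Icc c d := Icc_subset_Icc hca hbd
  have hgm' : MemLp ((Icc a b).indicator g) p (volume.restrict (Icc c d)) := by
    refine MemLp.mono_measure Measure.restrict_le_self ?_
    exact (memLp_indicator_iff_restrict measurableSet_Icc).2 hgm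
  have hgn : eLpNorm ((Icc a b).indicator g) p (volume.restrict (Icc c d))
      = eLpNorm g p (volume.restrict (Icc a b)) := by
    rw [eLpNorm_indicator_eq_eLpNorm_restrict measurableSet_Icc,
      Measure.restrict_restrict measurableSet_Icc, inter_eq_left.2 hsub]
  obtain ⟨U, dU, V, hU0, hU, hUeq, hdU, hV⟩ := hC _ hgm'
  rw [hgn] at hdU hV
  have hcb : Icc c b ⊆ Icc c d := Icc_subset_Icc_right hbd
  have hsub2 : Icc a b ⊆ Icc c b := Icc_subset_Icc_left hca
  have h1 := (h.indicator (J := Icc c a) (c := a) (left_mem_Icc.2 hab) (right_mem_Icc.2 hca)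
    (fun x hx => le_antisymm hx.2.2 hx.1.1) hu).1
  rw [union_comm, Icc_union_Icc_eq_Icc hca hab] at h1
  -- The right-hand side extended by zero to `[c, d]` has a solution `U` with the uniform constant.
  -- On `[c, b]` both `U` and the zero extension of `u` solve the same problem, so they agree. This
  -- is why uniqueness is required for every right endpoint.
  have hsolU : IsLinearSolution j p B c b ((Icc a b).indicator g) U :=
    ⟨hU0, dU, V, hU.mono hcb, ae_restrict_of_ae_restrict_of_subset hcb hUeq⟩
  have hsolu : IsLinearSolution j p B c b ((Icc a b).indicator g) ((Icc a b).indicator u) := by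
    refine ⟨?_, _, _, h1, Eventually.of_forall fun t => ?_⟩
    · by_cases hc : c ∈ Icc a b
      · rw [indicator_of_mem hc, le_antisymm hca hc.1, hu]
      · rw [indicator_of_notMem hc]
    · by_cases ht : t ∈ Icc a b <;> simp [ht, hg]
  have huniq := ((hB b (hca.trans_lt hab')) _ (memLp_restrict_mono hcb hgm')).2 _ _ hsolU hsolu
  have huniq' : EqOn U u (Icc a b) := fun t ht => by
    rw [huniq (hsub2 ht), indicator_of_mem ht]
  have hVv := (hU.mono hsub).ae_eq_dom hj h huniq'
  have hdd : dU =ᵐ[volume.restrict (Icc a b)] du := by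
    filter_upwards [hVv, ae_restrict_of_ae_restrict_of_subset hsub hUeq,
      ae_restrict_mem measurableSet_Icc] with t e1 e2 e3
    rw [indicator_of_mem e3, e1] at e2
    exact add_right_cancel e2
  have e1 : eLpNorm du p (volume.restrict (Icc a b))
      ≤ C * eLpNorm g p (volume.restrict (Icc a b)) := by
    rw [← eLpNorm_congr_ae hdd]
    exact (eLpNorm_restrict_mono hsub _).trans hdU
  have e2 : eLpNorm v p (volume.restrict (Icc a b))
      ≤ C * eLpNorm g p (volume.restrict (Icc a b)) := by
    rw [← eLpNorm_congr_ae hVv]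
    exact (eLpNorm_restrict_mono hsub _).trans hV
  have e3 := h.eLpNorm_le_mul_dom
  calc repNorm p (Icc a b) u du v
      ≤ ‖j‖₊ * (C * eLpNorm g p (volume.restrict (Icc a b)))
        + C * eLpNorm g p (volume.restrict (Icc a b))
        + C * eLpNorm g p (volume.restrict (Icc a b)) := by
        unfold repNorm
        gcongr
        exact e3.trans (by gcongr)
    _ = _ := by push_cast; ring

end LinearEstimates

end MaxReg

namespace MaxReg

/-! ### The nonlinear terms along curves in `X_p` -/

section Caratheodory

variable {E F : Type*} [NormedAddCommGroup E] [NormedAddCommGroup F]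

/-- For simple `φ` the composition is a finite sum of indicators times `f · x`; continuity in the
second argument carries measurability to the limit. -/
theorem aestronglyMeasurable_comp_of_caratheodory {μ : Measure ℝ} {f : ℝ → E → F}
    (hmeas : ∀ u, AEStronglyMeasurable (fun t => f t u) μ) (hcont : ∀ᵐ t ∂μ, Continuous (f t))
    {φ : ℝ → E} (hφ : AEStronglyMeasurable φ μ) :
    AEStronglyMeasurable (fun t => f t (φ t)) μ := by
  obtain ⟨ψ, hψ, heq⟩ := hφ
  have hsimple : ∀ s : SimpleFunc ℝ E, AEStronglyMeasurable (fun t => f t (s t)) μ := by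
    intro s
    have hs : (fun t => f t (s t))
        = ∑ x ∈ s.range, (s ⁻¹' {x}).indicator (fun t => f t x) := by
      ext t
      rw [Finset.sum_apply, Finset.sum_eq_single (s t)]
      · rw [indicator_of_mem (by simp)]
      · intro x _ hx
        rw [indicator_of_notMem]
        simpa using hx.symm
      · intro h
        exact absurd (s.mem_range_self t) h
    rw [hs]
    exact Finset.aestronglyMeasurable_sum _ fun x _ =>
      (hmeas x).indicator (s.measurableSet_fiber x)
  have hlim : AEStronglyMeasurable (fun t => f t (ψ t)) μ := by
    refine aestronglyMeasurable_of_tendsto_ae atTop (fun n => hsimple (hψ.approx n)) ?_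
    filter_upwards [hcont] with t ht
    exact (ht.tendsto _).comp (hψ.tendsto_approx t)
  refine hlim.congr ?_
  filter_upwards [heq] with t ht
  rw [ht]

/-- The exceptional null set in `hlip` depends on the pair `u₁, u₂`. The curves have compact, hence
separable, images, so one null set serves all pairs from a countable dense subset, and continuity of
`f t` extends the inequality to all pairs from the images. -/
theorem ae_norm_sub_le_along_curves {μ : Measure ℝ} {f : ℝ → E → F}
    (hcont : ∀ᵐ t ∂μ, Continuous (f t)) {Ψ : ℝ → ℝ} {R : ℝ}
    (hlip : ∀ u₁ u₂, ‖u₁‖ ≤ R → ‖u₂‖ ≤ R → ∀ᵐ t ∂μ, ‖f t u₁ - f t u₂‖ ≤ Ψ t * ‖u₁ - u₂‖)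
    {a b : ℝ} {φ₁ φ₂ : ℝ → E} (h₁ : ContinuousOn φ₁ (Icc a b)) (h₂ : ContinuousOn φ₂ (Icc a b))
    (hb₁ : ∀ t ∈ Icc a b, ‖φ₁ t‖ ≤ R) (hb₂ : ∀ t ∈ Icc a b, ‖φ₂ t‖ ≤ R) :
    ∀ᵐ t ∂μ, t ∈ Icc a b →
      ‖f t (φ₁ t) - f t (φ₂ t)‖ ≤ Ψ t * ‖φ₁ t - φ₂ t‖ := by
  have hS : IsCompact (φ₁ '' Icc a b ∪ φ₂ '' Icc a b) :=
    (isCompact_Icc.image_of_continuousOn h₁).union (isCompact_Icc.image_of_continuousOn h₂)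
  obtain ⟨D, hDS, hDc, hD⟩ := hS.isSeparable.exists_countable_dense_subset
  have hDR : ∀ x ∈ D, ‖x‖ ≤ R := by
    intro x hx
    rcases hDS hx with ⟨t, ht, rfl⟩ | ⟨t, ht, rfl⟩
    · exact hb₁ t ht
    · exact hb₂ t ht
  have hae : ∀ᵐ t ∂μ, ∀ x ∈ D, ∀ y ∈ D, ‖f t x - f t y‖ ≤ Ψ t * ‖x - y‖ := by
    rw [ae_ball_iff hDc]
    intro x hx
    rw [ae_ball_iff hDc]
    exact fun y hy => hlip x y (hDR x hx) (hDR y hy)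
  filter_upwards [hcont, hae] with t hc ht htI
  have hclosed : IsClosed {z : E × E | ‖f t z.1 - f t z.2‖ ≤ Ψ t * ‖z.1 - z.2‖} :=
    isClosed_le (by fun_prop) (by fun_prop)
  have hsub : D ×ˢ D ⊆ {z : E × E | ‖f t z.1 - f t z.2‖ ≤ Ψ t * ‖z.1 - z.2‖} :=
    fun z hz => ht z.1 hz.1 z.2 hz.2
  have hcl := closure_minimal hsub hclosed
  rw [closure_prod_eq] at hcl
  exact hcl (show (φ₁ t, φ₂ t) ∈ _ from
    ⟨hD (Or.inl ⟨t, htI, rfl⟩), hD (Or.inr ⟨t, htI, rfl⟩)⟩)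

theorem exists_norm_le_on_Icc {a b : ℝ} {φ : ℝ → E}
    (hφ : ContinuousOn φ (Icc a b)) : ∃ R : ℝ, 0 < R ∧ ∀ t ∈ Icc a b, ‖φ t‖ ≤ R := by
  obtain ⟨C, hC⟩ := isCompact_Icc.exists_bound_of_continuousOn hφ
  exact ⟨max C 1, lt_max_of_lt_right one_pos, fun t ht => (hC t ht).trans (le_max_left _ _)⟩

theorem memLp_clm_apply_of_continuousOn [NormedSpace ℝ E] [NormedSpace ℝ F] {p : ℝ≥0∞}
    {a b : ℝ} {A : ℝ → E →L[ℝ] F} {v : ℝ → E} (hA : ContinuousOn A (Icc a b))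
    (hv : MemLp v p (volume.restrict (Icc a b))) :
    MemLp (fun t => A t (v t)) p (volume.restrict (Icc a b)) := by
  obtain ⟨R, hR, hb⟩ := exists_norm_le_on_Icc hA
  refine MemLp.of_le_mul (c := R) hv ?_ ?_
  · exact isBoundedBilinearMap_apply.continuous.comp_aestronglyMeasurable
      ((hA.aestronglyMeasurable measurableSet_Icc).prodMk hv.1)
  · filter_upwards [ae_restrict_mem measurableSet_Icc] with t ht
    exact ((A t).le_opNorm (v t)).trans (mul_le_mul_of_nonneg_right (hb t ht) (norm_nonneg _))

end Caratheodory

variable {X₀ X₁ : Type*} [NormedAddCommGroup X₀] [NormedSpace ℝ X₀]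
  [NormedAddCommGroup X₁] [NormedSpace ℝ X₁] {j : X₁ →L[ℝ] X₀} {p : ℝ≥0∞} [Fact (1 ≤ p)]

/-- The right-hand side of the equation written with the fixed operator `B`. -/
def frozenRhs (A : ℝ → Xp j p → X₁ →L[ℝ] X₀) (f : ℝ → Xp j p → X₀) (B : X₁ →L[ℝ] X₀)
    (φ : ℝ → Xp j p) (v : ℝ → X₁) (t : ℝ) : X₀ :=
  f t (φ t) + (B - A t (φ t)) (v t)

section Nonlinear

variable {t₀ a b : ℝ} {A A' : ℝ → Xp j p → X₁ →L[ℝ] X₀} {f f' : ℝ → Xp j p → X₀}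
  {φ φ' : ℝ → Xp j p} {B : X₁ →L[ℝ] X₀} {v v' : ℝ → X₁}

theorem Assumptions.continuousOn_along (h : Assumptions j p t₀ A f) (ha : t₀ ≤ a)
    (hφ : ContinuousOn φ (Icc a b)) : ContinuousOn (fun t => A t (φ t)) (Icc a b) :=
  h.continuousOn_A.comp (continuousOn_id.prodMk hφ) fun _ ht => ⟨ha.trans ht.1, mem_univ _⟩

theorem Assumptions.memLp_f_along (h : Assumptions j p t₀ A f) (ha : t₀ ≤ a)
    (hφ : ContinuousOn φ (Icc a b)) :
    MemLp (fun t => f t (φ t)) p (volume.restrict (Icc a b)) := by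
  obtain ⟨R, hR, hb⟩ := exists_norm_le_on_Icc hφ
  obtain ⟨Ψ, hΨ, hlip⟩ := h.lipschitz_f R hR
  have hsub : Icc a b ⊆ Ici t₀ := fun t ht => ha.trans ht.1
  have hsub' : Icc a b ⊆ Icc t₀ b := Icc_subset_Icc_left ha
  have hle : volume.restrict (Icc a b) ≤ volume.restrict (Ici t₀) :=
    Measure.restrict_mono hsub le_rfl
  have hmeas := aestronglyMeasurable_comp_of_caratheodory
    (fun u => (h.measurable_f u).mono_measure hle) (ae_mono hle h.continuous_f)
    (hφ.aestronglyMeasurable measurableSet_Icc)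
  have hae := ae_norm_sub_le_along_curves h.continuous_f hlip hφ
    (continuousOn_const (c := (0 : Xp j p))) hb (fun _ _ => by simpa using hR.le)
  have h0 := memLp_restrict_mono hsub' (h.memLp_f_zero b)
  have h1 := memLp_restrict_mono hsub' (hΨ b)
  refine (h0.norm.add (h1.norm.const_mul R)).mono' hmeas ?_
  filter_upwards [ae_mono hle hae, ae_restrict_mem measurableSet_Icc] with t ht htI
  have h2 := ht htI
  rw [sub_zero] at h2
  have h3 : Ψ t * ‖φ t‖ ≤ R * ‖Ψ t‖ := by
    calc Ψ t * ‖φ t‖ ≤ ‖Ψ t‖ * ‖φ t‖ :=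
          mul_le_mul_of_nonneg_right (Real.le_norm_self _) (norm_nonneg _)
      _ ≤ ‖Ψ t‖ * R := mul_le_mul_of_nonneg_left (hb t htI) (norm_nonneg _)
      _ = R * ‖Ψ t‖ := mul_comm _ _
  have h4 := norm_sub_norm_le (f t (φ t)) (f t 0)
  simp only [Pi.add_apply]
  linarith

theorem Assumptions.memLp_frozenRhs (h : Assumptions j p t₀ A f) (ha : t₀ ≤ a)
    (hφ : ContinuousOn φ (Icc a b)) (hv : MemLp v p (volume.restrict (Icc a b))) :
    MemLp (frozenRhs A f B φ v) p (volume.restrict (Icc a b)) :=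
  (h.memLp_f_along ha hφ).add (memLp_clm_apply_of_continuousOn
    (A := fun t => B - A t (φ t)) (continuousOn_const.sub (h.continuousOn_along ha hφ)) hv)

/-- Comparison of the right-hand sides belonging to two problems, of which only the second needs to
be Lipschitz continuous. -/
theorem Assumptions.eLpNorm_frozenRhs_sub_le (h' : Assumptions j p t₀ A' f') (ha : t₀ ≤ a)
    {R L Z ε κ : ℝ} (hL0 : 0 ≤ L) (hZ0 : 0 ≤ Z) (hε0 : 0 ≤ ε) (hκ0 : 0 ≤ κ)
    (hL : ∀ t ∈ Icc a b, ∀ u₁ u₂ : Xp j p, ‖u₁‖ ≤ R → ‖u₂‖ ≤ R →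
      ∀ w : X₁, ‖A' t u₁ w - A' t u₂ w‖ ≤ L * ‖u₁ - u₂‖ * ‖w‖)
    {Ψ : ℝ → ℝ} (hΨm : MemLp Ψ p (volume.restrict (Icc a b)))
    (hΨ : ∀ u₁ u₂ : Xp j p, ‖u₁‖ ≤ R → ‖u₂‖ ≤ R →
      ∀ᵐ t ∂(volume.restrict (Ici t₀)), ‖f' t u₁ - f' t u₂‖ ≤ Ψ t * ‖u₁ - u₂‖)
    (hφ : ContinuousOn φ (Icc a b)) (hφ' : ContinuousOn φ' (Icc a b))
    (hb : ∀ t ∈ Icc a b, ‖φ t‖ ≤ R) (hb' : ∀ t ∈ Icc a b, ‖φ' t‖ ≤ R)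
    (hv : MemLp v p (volume.restrict (Icc a b))) (hv' : MemLp v' p (volume.restrict (Icc a b)))
    (hZ : ∀ t ∈ Icc a b, ‖φ t - φ' t‖ ≤ Z)
    (hf : ∀ t ∈ Icc a b, ‖f t (φ t) - f' t (φ t)‖ ≤ ε)
    (hA : ∀ t ∈ Icc a b, ‖A t (φ t) - A' t (φ t)‖ ≤ ε)
    (hκ : ∀ t ∈ Icc a b, ‖A t (φ t) - B‖ ≤ κ) :
    eLpNorm (fun t => frozenRhs A f B φ v t - frozenRhs A' f' B φ' v' t) p
        (volume.restrict (Icc a b))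
      ≤ ENNReal.ofReal ε * (eLpNorm (fun _ => (1 : ℝ)) p (volume.restrict (Icc a b))
            + eLpNorm v' p (volume.restrict (Icc a b)))
        + ENNReal.ofReal Z * (eLpNorm Ψ p (volume.restrict (Icc a b))
            + ENNReal.ofReal L * eLpNorm v' p (volume.restrict (Icc a b)))
        + ENNReal.ofReal κ * eLpNorm (v - v') p (volume.restrict (Icc a b)) := by
  have hp := Fact.out (p := 1 ≤ p)
  set μ := volume.restrict (Icc a b) with hμ
  have hle : μ ≤ volume.restrict (Ici t₀) :=
    Measure.restrict_mono (fun t ht => ha.trans ht.1) le_rfl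
  have hae := ae_mono hle (ae_norm_sub_le_along_curves h'.continuous_f hΨ hφ hφ' hb hb')
  let F₁ : ℝ → ℝ := (fun _ => (1 : ℝ)) + fun t => ‖v' t‖
  let F₂ : ℝ → ℝ := (fun t => ‖Ψ t‖) + L • fun t => ‖v' t‖
  let F₃ : ℝ → ℝ := fun t => ‖(v - v') t‖
  have hpt : ∀ᵐ t ∂μ, ‖frozenRhs A f B φ v t - frozenRhs A' f' B φ' v' t‖
      ≤ (ε • F₁ + Z • F₂ + κ • F₃) t := by
    filter_upwards [hae, ae_restrict_mem measurableSet_Icc] with t ht htI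
    -- Insert `f'` and `A'` at `φ`, so that the Lipschitz bounds of `(A', f')` suffice. The operator
    -- terms act on `v'`, except for the last one, where `A t (φ t) - B` is small and acts on `v -
    -- v'`.
    have e1 : frozenRhs A f B φ v t - frozenRhs A' f' B φ' v' t
        = (f t (φ t) - f' t (φ t)) + (f' t (φ t) - f' t (φ' t))
          - (A t (φ t) - A' t (φ t)) (v' t) - (A' t (φ t) (v' t) - A' t (φ' t) (v' t))
          - (A t (φ t) - B) (v t - v' t) := by
      simp only [frozenRhs, sub_apply, map_sub]
      abel
    rw [e1]
    have n1 := hf t htI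
    have n2 : ‖f' t (φ t) - f' t (φ' t)‖ ≤ Z * ‖Ψ t‖ := by
      refine (ht htI).trans ?_
      calc Ψ t * ‖φ t - φ' t‖ ≤ ‖Ψ t‖ * ‖φ t - φ' t‖ :=
            mul_le_mul_of_nonneg_right (Real.le_norm_self _) (norm_nonneg _)
        _ ≤ ‖Ψ t‖ * Z := mul_le_mul_of_nonneg_left (hZ t htI) (norm_nonneg _)
        _ = Z * ‖Ψ t‖ := mul_comm _ _
    have n3 : ‖(A t (φ t) - A' t (φ t)) (v' t)‖ ≤ ε * ‖v' t‖ :=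
      (ContinuousLinearMap.le_opNorm _ _).trans
        (mul_le_mul_of_nonneg_right (hA t htI) (norm_nonneg _))
    have n4 : ‖A' t (φ t) (v' t) - A' t (φ' t) (v' t)‖ ≤ Z * (L * ‖v' t‖) := by
      refine (hL t htI _ _ (hb t htI) (hb' t htI) (v' t)).trans ?_
      calc L * ‖φ t - φ' t‖ * ‖v' t‖ = ‖φ t - φ' t‖ * (L * ‖v' t‖) := by ring
        _ ≤ _ := mul_le_mul_of_nonneg_right (hZ t htI) (mul_nonneg hL0 (norm_nonneg _))
    have n5 : ‖(A t (φ t) - B) (v t - v' t)‖ ≤ κ * ‖v t - v' t‖ :=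
      (ContinuousLinearMap.le_opNorm _ _).trans
        (mul_le_mul_of_nonneg_right (hκ t htI) (norm_nonneg _))
    refine (norm_sub_le_of_le (norm_sub_le_of_le (norm_sub_le_of_le
      (norm_add_le_of_le n1 n2) n3) n4) n5).trans (le_of_eq ?_)
    simp only [F₁, F₂, F₃, Pi.add_apply, Pi.smul_apply, smul_eq_mul, Pi.sub_apply]
    ring
  have m1 : AEStronglyMeasurable (fun _ : ℝ => (1 : ℝ)) μ := aestronglyMeasurable_const
  have mv : AEStronglyMeasurable (fun t => ‖v' t‖) μ := hv'.1.norm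
  have mΨ : AEStronglyMeasurable (fun t => ‖Ψ t‖) μ := hΨm.1.norm
  have mF₁ : AEStronglyMeasurable F₁ μ := m1.add mv
  have mF₂ : AEStronglyMeasurable F₂ μ := mΨ.add (mv.const_smul L)
  have mF₃ : AEStronglyMeasurable F₃ μ := (hv.sub hv').1.norm
  have b1 : eLpNorm F₁ p μ ≤ eLpNorm (fun _ => (1 : ℝ)) p μ + eLpNorm v' p μ :=
    (eLpNorm_add_le m1 mv hp).trans_eq (by rw [eLpNorm_norm])
  have b2 : eLpNorm F₂ p μ ≤ eLpNorm Ψ p μ + ENNReal.ofReal L * eLpNorm v' p μ := by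
    refine (eLpNorm_add_le mΨ (mv.const_smul L) hp).trans_eq ?_
    rw [eLpNorm_const_smul, eLpNorm_norm, eLpNorm_norm, Real.enorm_of_nonneg hL0]
  have b3 : eLpNorm F₃ p μ = eLpNorm (v - v') p μ := eLpNorm_norm _
  refine (eLpNorm_mono_ae_real hpt).trans ?_
  refine (eLpNorm_add_le ((mF₁.const_smul ε).add (mF₂.const_smul Z)) (mF₃.const_smul κ) hp).trans ?_
  refine add_le_add ((eLpNorm_add_le (mF₁.const_smul ε) (mF₂.const_smul Z) hp).trans
    (add_le_add ?_ ?_)) ?_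
  · rw [eLpNorm_const_smul, Real.enorm_of_nonneg hε0]
    gcongr
  · rw [eLpNorm_const_smul, Real.enorm_of_nonneg hZ0]
    gcongr
  · rw [eLpNorm_const_smul, Real.enorm_of_nonneg hκ0, b3]

end Nonlinear

end MaxReg

namespace MaxReg

theorem eLpNorm_dom_le_repNorm {E F : Type*} [NormedAddCommGroup E] [NormedAddCommGroup F]
    {p : ℝ≥0∞}     (I : Set ℝ) (u du : ℝ → E) (v : ℝ → F) :
    eLpNorm v p (volume.restrict I) ≤ repNorm p I u du v := le_add_self

variable {X₀ X₁ : Type*} [NormedAddCommGroup X₀] [NormedSpace ℝ X₀]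
  [NormedAddCommGroup X₁] [NormedSpace ℝ X₁] {j : X₁ →L[ℝ] X₀} {p : ℝ≥0∞} [Fact (1 ≤ p)]

/-! ### Local existence -/

/-- `φ ∈ E₁([a, b])` solves `φ' + A(t, φ) φ = f(t, φ)` a.e. on `[a, b]`. -/
def SolvesOn (j : X₁ →L[ℝ] X₀) (p : ℝ≥0∞) [Fact (1 ≤ p)] (A : ℝ → Xp j p → X₁ →L[ℝ] X₀)
    (f : ℝ → Xp j p → X₀) (a b : ℝ) (φ : ℝ → Xp j p) : Prop :=
  ∃ (dφ : ℝ → X₀) (v : ℝ → X₁), IsE1Rep j p (Icc a b) (fun t => (φ t).toX₀) dφ v ∧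
    ∀ᵐ t ∂(volume.restrict (Icc a b)), dφ t + A t (φ t) (v t) = f t (φ t)

theorem Xp.norm_le_of_traceENorm_le {x : Xp j p} {r : ℝ} (hr : 0 ≤ r)
    (h : traceENorm j p x.toX₀ ≤ ENNReal.ofReal r) : ‖x‖ ≤ r := by
  rw [← Xp.enorm_eq, ← ofReal_norm] at h
  exact (ENNReal.ofReal_le_ofReal_iff hr).1 h

/-- Contraction argument in the linear right-hand side. Let `F` be an `E₁` extension of `x` and `B =
A s x`. For `g` in `L^p` let `ζ g` solve `ζ' + B ζ = g` with zero initial value, and put `ψ g = F +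
ζ g`. Then `ψ g` solves the nonlinear equation when `g` is a fixed point of `S g = f(ψ g) + (B - A(ψ
g)) ψ g - (F' + B F)`. -/
theorem Assumptions.exists_local_solution [CompleteSpace X₀] [CompleteSpace X₁] {t₀ : ℝ}
    {A : ℝ → Xp j p → X₁ →L[ℝ] X₀} {f : ℝ → Xp j p → X₀} (h : Assumptions j p t₀ A f)
    (hj : Function.Injective j) (hp_top : p ≠ ∞) {s : ℝ} (hs : t₀ ≤ s) (x : Xp j p) :
    ∃ δ : ℝ, 0 < δ ∧ ∃ ψ : ℝ → Xp j p, ψ s = x ∧ SolvesOn j p A f s (s + δ) ψ := by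
  have hp := Fact.out (p := 1 ≤ p)
  obtain ⟨F, dF, vF, hFs, hF, hFlt⟩ := exists_extension x.traceENorm_lt_top s
  set Φ : ℝ → Xp j p := fun t => Xp.ofX₀ j p (F t) with hΦdef
  have hΦF : ∀ t, s ≤ t → (Φ t).toX₀ = F t := fun t ht =>
    Xp.toX₀_ofX₀ ((hF.traceENorm_le_repNorm_Ici ht).trans_lt hF.repNorm_lt_top)
  have hΦs : Φ s = x := by rw [hΦdef]; simp only [hFs, Xp.ofX₀_toX₀]
  have hFI : ∀ d, IsE1Rep j p (Icc s d) F dF vF := fun d => hF.mono fun _ ht => ht.1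
  have hΦrep : ∀ d, IsE1Rep j p (Icc s d) (fun t => (Φ t).toX₀) dF vF := fun d =>
    (hFI d).congr (fun t ht => (hΦF t ht.1).symm) (ae_eq_refl _) (ae_eq_refl _)
  have hΦc : ∀ d, ContinuousOn Φ (Icc s d) := fun d => (hΦrep d).continuousOn_Xp hp_top
  obtain ⟨R₀, hR₀, hΦb⟩ := exists_norm_le_on_Icc (hΦc (s + 1))
  -- `R` bounds both the `X_p` norms (`R₀` for the reference curve, `1` for the deviation) and the
  -- elapsed time, since the Lipschitz condition on `A` holds on `[t₀, t₀ + R]`.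
  set R := max (R₀ + 1) (s + 1 - t₀) with hRdef
  have hR : 0 < R := lt_max_of_lt_left (by linarith)
  obtain ⟨L, hL0, hL⟩ := h.lipschitz_A R hR
  obtain ⟨Ψ, hΨm, hΨ⟩ := h.lipschitz_f R hR
  set B := A s x with hB
  obtain ⟨C, hC⟩ := exists_repNorm_le_of_maximalRegularity hj (lt_add_one s)
    (fun b hb => h.maximalRegularity s hs x s b hb)
  set K : ℝ := (C : ℝ) + 1 with hK
  have hC0 : (0 : ℝ) ≤ C := C.2
  have hK0 : 0 < K := by positivity
  -- `c` will bound `‖Ψ‖`, `‖vF‖`, `‖vζ g‖` and `‖A(ψ g) - B‖`. The difference of two right-hand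
  -- sides at distance `D` is then at most `D * (c + L * (2 * c)) + c * D = c * (2 + 2 * L) * D = D
  -- / (4 * K)`.
  set c : ℝ := 1 / (8 * K * (L + 1)) with hc
  have hc0 : 0 < c := by positivity
  have hcK : c * (2 + 2 * L) = 1 / (4 * K) := by
    rw [hc]; field_simp; ring
  obtain ⟨η, hη, hAη⟩ := Metric.continuousWithinAt_iff.1
    (h.continuousOn_A (s, x) ⟨hs, mem_univ _⟩) c hc0
  have hAη' : ∀ t, t₀ ≤ t → |t - s| < η → ∀ y : Xp j p, ‖y - x‖ < η → ‖A t y - B‖ ≤ c := by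
    intro t ht hts y hy
    have := hAη (x := (t, y)) ⟨ht, mem_univ _⟩ (by
      rw [Prod.dist_eq, max_lt_iff, Real.dist_eq, dist_eq_norm]; exact ⟨hts, hy⟩)
    rw [dist_eq_norm] at this
    exact this.le
  -- `r` limits the deviation of `ψ g` from the reference curve: `c` for the `X₁` part, `1` to stay
  -- within norm `R`, and `η / 2` to stay where `A` is within `c` of `B`. The radius `ρ = r / K` of
  -- the ball for `g` guarantees this.
  set r := min c (min 1 (η / 2)) with hr
  have hr0 : 0 < r := lt_min hc0 (lt_min one_pos (half_pos hη))
  have hrc : r ≤ c := min_le_left _ _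
  have hr1 : r ≤ 1 := (min_le_right _ _).trans (min_le_left _ _)
  have hrη : r ≤ η / 2 := (min_le_right _ _).trans (min_le_right _ _)
  set ρ := r / K with hρ
  have hρ0 : 0 < ρ := by positivity
  have hCρ : C * ρ ≤ r := by
    rw [hρ, mul_div_assoc', div_le_iff₀ hK0, mul_comm]
    exact mul_le_mul_of_nonneg_left (by linarith) hr0.le
  -- The residual of the reference curve, that is `S g` with `F` in place of `ψ g`. A short interval
  -- makes it at most `ρ / 2`, which `S` needs in order to preserve the ball.
  set G₀ : ℝ → X₀ := fun t => frozenRhs A f B Φ vF t - (dF t + B (vF t)) with hG₀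
  have hBF : ∀ d, MemLp (fun t => dF t + B (vF t)) p (volume.restrict (Icc s d)) := fun d =>
    (hFI d).memLp_deriv.add (B.comp_memLp' (hFI d).memLp_dom)
  have hG₀m : MemLp G₀ p (volume.restrict (Icc s (s + 1))) :=
    (h.memLp_frozenRhs hs (hΦc _) (hFI _).memLp_dom).sub (hBF _)
  obtain ⟨δ₁, hδ₁, hδ₁'⟩ := Metric.continuousWithinAt_iff.1
    (hΦc (s + 1) s (left_mem_Icc.2 (by linarith))) (η / 2) (half_pos hη)
  obtain ⟨δ₂, hδ₂, hδ₂'⟩ := exists_eLpNorm_Icc_le hp_top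
    (memLp_restrict_mono (Icc_subset_Icc_left hs) (hΨm (s + 1))) hc0
  obtain ⟨δ₃, hδ₃, hδ₃'⟩ := exists_eLpNorm_Icc_le hp_top (hFI (s + 1)).memLp_dom hc0
  obtain ⟨δ₄, hδ₄, hδ₄'⟩ := exists_eLpNorm_Icc_le hp_top hG₀m (half_pos hρ0)
  obtain ⟨δ, hδ0, hδ1, hδη, hδδ₁, hδδ₂, hδδ₃, hδδ₄⟩ : ∃ δ : ℝ, 0 < δ ∧ δ ≤ 1 ∧ δ < η ∧ δ < δ₁ ∧
      δ ≤ δ₂ ∧ δ ≤ δ₃ ∧ δ ≤ δ₄ := by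
    have hm : 0 < min 1 (min η (min δ₁ (min δ₂ (min δ₃ δ₄)))) := by positivity
    refine ⟨min 1 (min η (min δ₁ (min δ₂ (min δ₃ δ₄)))) / 2, half_pos hm, ?_⟩
    have := half_lt_self hm
    simp only [lt_min_iff] at this
    refine ⟨this.1.le, this.2.1, this.2.2.1, this.2.2.2.1.le, this.2.2.2.2.1.le,
      this.2.2.2.2.2.le⟩
  refine ⟨δ, hδ0, ?_⟩
  set I := Icc s (s + δ) with hI
  set μ := volume.restrict I with hμ
  have hIsub : I ⊆ Icc s (s + 1) := Icc_subset_Icc_right (by linarith)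
  have hΨI : eLpNorm Ψ p μ ≤ ENNReal.ofReal c := hδ₂' _ _ hIsub (by linarith)
  have hvFI : eLpNorm vF p μ ≤ ENNReal.ofReal c := hδ₃' _ _ hIsub (by linarith)
  have hG₀I : eLpNorm G₀ p μ ≤ ENNReal.ofReal (ρ / 2) := hδ₄' _ _ hIsub (by linarith)
  have hΦx : ∀ t ∈ I, ‖Φ t - x‖ < η / 2 := by
    intro t ht
    have := hδ₁' (hIsub ht) (by rw [Real.dist_eq, abs_lt]; constructor <;> linarith [ht.1, ht.2])
    rwa [hΦs, dist_eq_norm] at this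
  have hsol : ∀ g : Lp X₀ p μ, ∃ (ζ dζ : ℝ → X₀) (vζ : ℝ → X₁), ζ s = 0 ∧
      IsE1Rep j p I ζ dζ vζ ∧ ∀ᵐ t ∂μ, dζ t + B (vζ t) = g t := by
    intro g
    obtain ⟨ζ, hζ0, dζ, vζ, h1, h2⟩ :=
      (h.maximalRegularity s hs x s (s + δ) (by linarith) g (Lp.memLp g)).1
    exact ⟨ζ, dζ, vζ, hζ0, h1, h2⟩
  -- The chosen solutions need not be linear in `g`. Differences are controlled by applying the a
  -- priori estimate to them directly, as in `hest2`.
  choose ζ dζ vζ hζ0 hζ hζeq using hsol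
  have hest : ∀ g, repNorm p I (ζ g) (dζ g) (vζ g) ≤ ENNReal.ofReal (C * ‖g‖) := by
    intro g
    refine (hC s (s + δ) le_rfl (by linarith) (by linarith) _ _ _ (hζ g) (hζ0 g)).trans_eq ?_
    rw [eLpNorm_congr_ae (hζeq g), ENNReal.ofReal_mul hC0, ofReal_norm, Lp.enorm_def]
    simp
  have hest2 : ∀ g k, repNorm p I (ζ g - ζ k) (dζ g - dζ k) (vζ g - vζ k)
      ≤ ENNReal.ofReal (C * ‖g - k‖) := by
    intro g k
    refine (hC s (s + δ) le_rfl (by linarith) (by linarith) _ _ _ ((hζ g).sub (hζ k))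
      (by simp [hζ0])).trans_eq ?_
    have : (fun t => (dζ g - dζ k) t + B ((vζ g - vζ k) t)) =ᵐ[μ] ⇑(g - k) := by
      filter_upwards [hζeq g, hζeq k, Lp.coeFn_sub g k] with t h1 h2 h3
      refine Eq.trans ?_ h3.symm
      change _ = (g : ℝ → X₀) t - (k : ℝ → X₀) t
      rw [← h1, ← h2]
      simp only [Pi.sub_apply, map_sub]
      abel
    rw [eLpNorm_congr_ae this, ENNReal.ofReal_mul hC0, ofReal_norm, Lp.enorm_def]
    simp
  set ψ : Lp X₀ p μ → ℝ → Xp j p := fun g t => Xp.ofX₀ j p (F t + ζ g t) with hψ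
  have hζtr : ∀ g, ∀ t ∈ I, traceENorm j p (ζ g t) ≤ ENNReal.ofReal (C * ‖g‖) := fun g t ht =>
    ((hζ g).traceENorm_le_of_left_eq_zero (hζ0 g) ht).trans (hest g)
  have hψF : ∀ g, ∀ t ∈ I, (ψ g t).toX₀ = F t + ζ g t := by
    intro g t ht
    refine Xp.toX₀_ofX₀ ((traceENorm_add_le _ _).trans_lt (ENNReal.add_lt_top.2 ⟨?_, ?_⟩))
    · exact (hF.traceENorm_le_repNorm_Ici ht.1).trans_lt hF.repNorm_lt_top
    · exact (hζtr g t ht).trans_lt ENNReal.ofReal_lt_top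
  have hψrep : ∀ g, IsE1Rep j p I (fun t => (ψ g t).toX₀) (dF + dζ g) (vF + vζ g) := fun g =>
    ((hFI _).add (hζ g)).congr (fun t ht => (hψF g t ht).symm) (ae_eq_refl _) (ae_eq_refl _)
  have hψc : ∀ g, ContinuousOn (ψ g) I := fun g => (hψrep g).continuousOn_Xp hp_top
  have hψΦ : ∀ g, ∀ t ∈ I, ‖ψ g t - Φ t‖ ≤ C * ‖g‖ := by
    intro g t ht
    refine Xp.norm_le_of_traceENorm_le (by positivity) ?_
    rw [map_sub, hψF g t ht, hΦF t ht.1, add_sub_cancel_left]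
    exact hζtr g t ht
  have hψψ : ∀ g k, ∀ t ∈ I, ‖ψ g t - ψ k t‖ ≤ C * ‖g - k‖ := by
    intro g k t ht
    refine Xp.norm_le_of_traceENorm_le (by positivity) ?_
    rw [map_sub, hψF g t ht, hψF k t ht, add_sub_add_left_eq_sub]
    exact (((hζ g).sub (hζ k)).traceENorm_le_of_left_eq_zero (by simp [hζ0]) ht).trans (hest2 g k)
  have hψs : ∀ g, ψ g s = x := by
    intro g
    rw [hψ]; simp only [hFs, hζ0, add_zero, Xp.ofX₀_toX₀]
  have hsmall : ∀ g : Lp X₀ p μ, ‖g‖ ≤ ρ → ∀ t ∈ I, ‖ψ g t‖ ≤ R ∧ ‖A t (ψ g t) - B‖ ≤ c := by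
    intro g hg t ht
    have h1 : ‖ψ g t - Φ t‖ ≤ r :=
      (hψΦ g t ht).trans ((mul_le_mul_of_nonneg_left hg hC0).trans hCρ)
    constructor
    · have h2 := norm_le_norm_add_norm_sub' (ψ g t) (Φ t)
      have h3 := hΦb t (hIsub ht)
      exact le_trans (by linarith) (le_max_left _ _)
    · refine hAη' t (hs.trans ht.1) ?_ _ ?_
      · rw [abs_lt]; constructor <;> linarith [ht.1, ht.2]
      · have h2 := norm_sub_le_norm_sub_add_norm_sub (ψ g t) (Φ t) x
        linarith [hΦx t ht]
  have hΦsmall : ∀ t ∈ I, ‖Φ t‖ ≤ R := fun t ht =>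
    (hΦb t (hIsub ht)).trans (le_trans (by linarith) (le_max_left _ _))
  have hvbound : ∀ g : Lp X₀ p μ, ‖g‖ ≤ ρ →
      eLpNorm (vF + vζ g) p μ ≤ ENNReal.ofReal (c + c) := by
    intro g hg
    refine (eLpNorm_add_le (hFI _).memLp_dom.1 (hζ g).memLp_dom.1 hp).trans ?_
    rw [ENNReal.ofReal_add hc0.le hc0.le]
    refine add_le_add hvFI ((eLpNorm_dom_le_repNorm _ _ _ _).trans ((hest g).trans ?_))
    exact ENNReal.ofReal_le_ofReal
      (((mul_le_mul_of_nonneg_left hg hC0).trans hCρ).trans hrc)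
  -- Used twice: against the reference curve `Φ` for the self-mapping property, and against `ψ k`
  -- for the contraction property.
  have hcomp : ∀ g : Lp X₀ p μ, ‖g‖ ≤ ρ → ∀ (φ' : ℝ → Xp j p) (v' : ℝ → X₁) (D : ℝ), 0 ≤ D →
      ContinuousOn φ' I → (∀ t ∈ I, ‖φ' t‖ ≤ R) → MemLp v' p μ →
      eLpNorm v' p μ ≤ ENNReal.ofReal (c + c) →
      (∀ t ∈ I, ‖ψ g t - φ' t‖ ≤ D) → eLpNorm ((vF + vζ g) - v') p μ ≤ ENNReal.ofReal D →
      eLpNorm (fun t => frozenRhs A f B (ψ g) (vF + vζ g) t - frozenRhs A f B φ' v' t) p μ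
        ≤ ENNReal.ofReal (D / (4 * K)) := by
    intro g hg φ' v' D hD hφ'c hφ' hv' h2 hZ hvv
    have hvg : MemLp (vF + vζ g) p μ := (hψrep g).memLp_dom
    have h1 := h.eLpNorm_frozenRhs_sub_le (A := A) (f := f) (B := B) hs hL0.le hD le_rfl hc0.le
      (R := R) (a := s) (b := s + δ) (ε := 0)
      (fun t ht => hL t ⟨hs.trans ht.1, by
        have := le_max_right (R₀ + 1) (s + 1 - t₀)
        linarith [ht.2]⟩)
      (memLp_restrict_mono (Icc_subset_Icc hs (by linarith)) (hΨm (s + 1))) hΨ (hψc g) hφ'c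
      (fun t ht => (hsmall g hg t ht).1) hφ' hvg hv' hZ
      (fun t ht => by simp) (fun t ht => by simp) (fun t ht => (hsmall g hg t ht).2)
    refine h1.trans ?_
    calc _ ≤ ENNReal.ofReal 0 * (eLpNorm (fun _ => (1 : ℝ)) p μ + eLpNorm v' p μ)
          + ENNReal.ofReal D * (ENNReal.ofReal c + ENNReal.ofReal L * ENNReal.ofReal (c + c))
          + ENNReal.ofReal c * ENNReal.ofReal D := by gcongr
      _ = ENNReal.ofReal (D / (4 * K)) := by
        rw [ENNReal.ofReal_zero, zero_mul, zero_add, ← ENNReal.ofReal_mul hL0.le,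
          ← ENNReal.ofReal_add hc0.le (by positivity), ← ENNReal.ofReal_mul hD,
          ← ENNReal.ofReal_mul hc0.le, ← ENNReal.ofReal_add (by positivity) (by positivity)]
        congr 1
        rw [div_eq_mul_one_div, ← hcK]
        ring
  have hTm : ∀ g : Lp X₀ p μ,
      MemLp (fun t => frozenRhs A f B (ψ g) (vF + vζ g) t - (dF t + B (vF t))) p μ := fun g =>
    (h.memLp_frozenRhs hs (hψc g) (hψrep g).memLp_dom).sub (hBF _)
  set S : Lp X₀ p μ → Lp X₀ p μ := fun g => (hTm g).toLp _ with hS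
  have hmaps : MapsTo S (Metric.closedBall 0 ρ) (Metric.closedBall 0 ρ) := by
    intro g hg
    rw [mem_closedBall_zero_iff] at hg ⊢
    have hD : (0 : ℝ) ≤ C * ‖g‖ := by positivity
    have h1 := hcomp g hg Φ vF (C * ‖g‖) hD (hΦc _) hΦsmall (hFI _).memLp_dom
      (hvFI.trans (ENNReal.ofReal_le_ofReal (by linarith))) (hψΦ g) (by
      rw [add_sub_cancel_left]
      exact (eLpNorm_dom_le_repNorm _ _ _ _).trans (hest g))
    have h2 : eLpNorm (fun t => frozenRhs A f B (ψ g) (vF + vζ g) t - (dF t + B (vF t))) p μ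
        ≤ ENNReal.ofReal (C * ‖g‖ / (4 * K)) + ENNReal.ofReal (ρ / 2) := by
      have e : (fun t => frozenRhs A f B (ψ g) (vF + vζ g) t - (dF t + B (vF t)))
          = (fun t => frozenRhs A f B (ψ g) (vF + vζ g) t - frozenRhs A f B Φ vF t) + G₀ := by
        ext t; simp [hG₀]
      rw [e]
      refine (eLpNorm_add_le ?_ (memLp_restrict_mono hIsub hG₀m).1 hp).trans (add_le_add h1 hG₀I)
      exact ((h.memLp_frozenRhs hs (hψc g) (hψrep g).memLp_dom).sub
        (h.memLp_frozenRhs hs (hΦc _) (hFI _).memLp_dom)).1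
    rw [← ENNReal.ofReal_add (by positivity) (by positivity)] at h2
    rw [hS, Lp.norm_toLp]
    refine (ENNReal.toReal_mono ENNReal.ofReal_ne_top h2).trans ?_
    rw [ENNReal.toReal_ofReal (by positivity)]
    have h3 : C * ‖g‖ / (4 * K) ≤ ρ / 2 := by
      rw [div_le_iff₀ (by positivity)]
      have : C * ‖g‖ ≤ K * ρ := mul_le_mul (by linarith) hg (norm_nonneg _) hK0.le
      nlinarith [mul_pos hK0 hρ0]
    linarith
  have hcontr : ContractingWith (1 / 2) (hmaps.restrict S _ _) := by
    refine ⟨by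
      rw [← NNReal.coe_lt_coe]; norm_num, LipschitzWith.of_dist_le_mul ?_⟩
    rintro ⟨g, hg⟩ ⟨k, hk⟩
    rw [mem_closedBall_zero_iff] at hg hk
    rw [Subtype.dist_eq, Subtype.dist_eq]
    simp only [MapsTo.val_restrict_apply, dist_eq_norm]
    have hD : (0 : ℝ) ≤ C * ‖g - k‖ := by positivity
    have h1 := hcomp g hg (ψ k) (vF + vζ k) (C * ‖g - k‖) hD (hψc k)
      (fun t ht => (hsmall k hk t ht).1) (hψrep k).memLp_dom (hvbound k hk) (hψψ g k) (by
        rw [add_sub_add_left_eq_sub]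
        exact (eLpNorm_dom_le_repNorm _ _ _ _).trans (hest2 g k))
    have e : S g - S k = ((hTm g).sub (hTm k)).toLp _ := (MemLp.toLp_sub _ _).symm
    rw [e, Lp.norm_toLp]
    have e2 : ((fun t => frozenRhs A f B (ψ g) (vF + vζ g) t - (dF t + B (vF t)))
        - fun t => frozenRhs A f B (ψ k) (vF + vζ k) t - (dF t + B (vF t)))
        = fun t => frozenRhs A f B (ψ g) (vF + vζ g) t - frozenRhs A f B (ψ k) (vF + vζ k) t := by
      ext t; simp
    rw [e2]
    refine (ENNReal.toReal_mono ENNReal.ofReal_ne_top h1).trans ?_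
    rw [ENNReal.toReal_ofReal (by positivity), div_le_iff₀ (by positivity)]
    have h2 : C * ‖g - k‖ ≤ K * ‖g - k‖ :=
      mul_le_mul_of_nonneg_right (by linarith) (norm_nonneg _)
    have h3 : 0 ≤ K * ‖g - k‖ := by positivity
    push_cast
    linarith
  obtain ⟨g, -, hfix, -⟩ := hcontr.exists_fixedPoint' Metric.isClosed_closedBall.isComplete hmaps
    (Metric.mem_closedBall_self hρ0.le) (edist_ne_top _ _)
  refine ⟨ψ g, hψs g, dF + dζ g, vF + vζ g, hψrep g, ?_⟩
  have hfix' : (hTm g).toLp _ = g := hfix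
  filter_upwards [hζeq g, (hTm g).coeFn_toLp] with t h1 h2
  rw [hfix', ← h1] at h2
  simp only [frozenRhs, sub_apply] at h2
  have h3 : (dF + dζ g) t + B ((vF + vζ g) t) = dζ g t + B (vζ g t) + (dF t + B (vF t)) := by
    simp only [Pi.add_apply, map_add]; abel
  have h4 : (dF + dζ g) t = dζ g t + B (vζ g t) + (dF t + B (vF t)) - B ((vF + vζ g) t) := by
    rw [← h3]; abel
  rw [h4, h2]
  abel

end MaxReg

namespace MaxReg

/-! ### Continuation of solutions -/

theorem eLpNorm_deriv_le_repNorm {E F : Type*} [NormedAddCommGroup E] [NormedAddCommGroup F]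
    {p : ℝ≥0∞} (I : Set ℝ) (u du : ℝ → E) (v : ℝ → F) :
    eLpNorm du p (volume.restrict I) ≤ repNorm p I u du v := by
  rw [repNorm, add_assoc, add_left_comm]
  exact le_self_add

/-- Fatou's lemma for the truncations of `g` to `[a, τ n]` with `τ n` increasing to `b`. -/
theorem memLp_Icc_of_forall_lt {E : Type*} [NormedAddCommGroup E] {p : ℝ≥0∞} {a b : ℝ}
    (hab : a < b) {g : ℝ → E} {M : ℝ≥0∞} (hM : M < ∞)
    (hg : ∀ τ ∈ Ico a b, MemLp g p (volume.restrict (Icc a τ)) ∧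
      eLpNorm g p (volume.restrict (Icc a τ)) ≤ M) :
    MemLp g p (volume.restrict (Icc a b)) := by
  obtain ⟨τ, -, hτ, hτlim⟩ := exists_seq_strictMono_tendsto' hab
  have hτ' : ∀ n, τ n ∈ Ico a b := fun n => ⟨(hτ n).1.le, (hτ n).2⟩
  have hsub : ∀ n, Icc a (τ n) ⊆ Icc a b := fun n => Icc_subset_Icc_right (hτ' n).2.le
  have hres : ∀ n, (volume.restrict (Icc a b)).restrict (Icc a (τ n))
      = volume.restrict (Icc a (τ n)) := fun n => by
    rw [Measure.restrict_restrict measurableSet_Icc, inter_eq_left.2 (hsub n)]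
  have hm : ∀ n, AEStronglyMeasurable ((Icc a (τ n)).indicator g) (volume.restrict (Icc a b)) :=
    fun n => by
      rw [aestronglyMeasurable_indicator_iff measurableSet_Icc, hres]
      exact (hg _ (hτ' n)).1.1
  have hae : ∀ᵐ t ∂(volume.restrict (Icc a b)), t < b := by
    filter_upwards [ae_restrict_mem measurableSet_Icc,
      ae_restrict_of_ae (Measure.ae_ne volume b)] with t ht hne
    exact lt_of_le_of_ne ht.2 hne
  have hlim : ∀ᵐ t ∂(volume.restrict (Icc a b)),
      Tendsto (fun n => (Icc a (τ n)).indicator g t) atTop (𝓝 (g t)) := by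
    filter_upwards [ae_restrict_mem measurableSet_Icc, hae] with t ht htb
    refine tendsto_const_nhds.congr' ?_
    filter_upwards [hτlim.eventually_const_le htb] with n hn
    rw [indicator_of_mem (show t ∈ Icc a (τ n) from ⟨ht.1, hn⟩)]
  refine ⟨aestronglyMeasurable_of_tendsto_ae atTop hm hlim, lt_of_le_of_lt ?_ hM⟩
  refine (Lp.eLpNorm_lim_le_liminf_eLpNorm hm g hlim).trans ?_
  refine liminf_le_of_le (by isBoundedDefault) fun B hB => ?_
  obtain ⟨n, hn⟩ := hB.exists
  refine hn.trans ?_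
  rw [eLpNorm_indicator_eq_eLpNorm_restrict measurableSet_Icc, hres]
  exact (hg _ (hτ' n)).2

variable {X₀ X₁ : Type*} [NormedAddCommGroup X₀] [NormedSpace ℝ X₀]
  [NormedAddCommGroup X₁] [NormedSpace ℝ X₁] {j : X₁ →L[ℝ] X₀} {p : ℝ≥0∞} [Fact (1 ≤ p)]

/-- An `E₁` function on `[a, b)` with finite norm extends to `[a, b]`. -/
theorem exists_rep_Icc_of_forall_lt {a b : ℝ} (hab : a < b) {u du : ℝ → X₀} {v : ℝ → X₁}
    {M : ℝ≥0∞} (hM : M < ∞)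
    (h : ∀ τ ∈ Ico a b, IsE1Rep j p (Icc a τ) u du v ∧ repNorm p (Icc a τ) u du v ≤ M) :
    ∃ u', EqOn u' u (Ico a b) ∧ IsE1Rep j p (Icc a b) u' du v := by
  have hdu : MemLp du p (volume.restrict (Icc a b)) := memLp_Icc_of_forall_lt hab hM fun τ hτ =>
    ⟨(h τ hτ).1.memLp_deriv, (eLpNorm_deriv_le_repNorm _ _ _ _).trans (h τ hτ).2⟩
  have hv : MemLp v p (volume.restrict (Icc a b)) := memLp_Icc_of_forall_lt hab hM fun τ hτ =>
    ⟨(h τ hτ).1.memLp_dom, (eLpNorm_dom_le_repNorm _ _ _ _).trans (h τ hτ).2⟩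
  have heq : EqOn (fun t => u a + ∫ r in a..t, du r) u (Ico a b) := by
    intro t ht
    simp only
    rw [← (h t ht).1.sub_eq_integral a (left_mem_Icc.2 ht.1) t (right_mem_Icc.2 ht.1),
      add_sub_cancel]
  have hmem : MemLp (fun t => u a + ∫ r in a..t, du r) p (volume.restrict (Icc a b)) :=
    MemLp.add (memLp_const (u a)) (memLp_primitive hdu)
  have hembed : ∀ᵐ t ∂(volume.restrict (Icc a b)), j (v t) = u a + ∫ r in a..t, du r := by
    obtain ⟨τ, -, hτ, hτlim⟩ := exists_seq_strictMono_tendsto' hab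
    have hτ' : ∀ n, τ n ∈ Ico a b := fun n => ⟨(hτ n).1.le, (hτ n).2⟩
    have hall : ∀ᵐ t ∂(volume : Measure ℝ), ∀ n, t ∈ Icc a (τ n) → j (v t) = u t :=
      ae_all_iff.2 fun n => (ae_restrict_iff' measurableSet_Icc).1 (h _ (hτ' n)).1.embed_ae_eq
    filter_upwards [ae_restrict_mem measurableSet_Icc, ae_restrict_of_ae hall,
      ae_restrict_of_ae (Measure.ae_ne volume b)] with t ht h1 hne
    have htb : t < b := lt_of_le_of_ne ht.2 hne
    obtain ⟨n, hn⟩ := (hτlim.eventually_const_le htb).exists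
    rw [h1 n ⟨ht.1, hn⟩]
    exact (heq ⟨ht.1, htb⟩).symm
  refine ⟨fun t => u a + ∫ r in a..t, du r, heq, hmem, hdu, hv, fun s hs t ht => ?_, hembed⟩
  have hc : a ∈ Icc a b := left_mem_Icc.2 hab.le
  rw [add_sub_add_left_eq_sub]
  exact intervalIntegral.integral_interval_sub_left
    (intervalIntegrable_of_memLp hdu hc ht) (intervalIntegrable_of_memLp hdu hc hs)

variable {A : ℝ → Xp j p → X₁ →L[ℝ] X₀} {f : ℝ → Xp j p → X₀} {a b c : ℝ} {φ ψ : ℝ → Xp j p}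

namespace SolvesOn

theorem mono (h : SolvesOn j p A f a b φ) {a' b' : ℝ} (hsub : Icc a' b' ⊆ Icc a b) :
    SolvesOn j p A f a' b' φ := by
  obtain ⟨d, v, h1, h2⟩ := h
  exact ⟨d, v, h1.mono hsub, ae_restrict_of_ae_restrict_of_subset hsub h2⟩

theorem continuousOn (h : SolvesOn j p A f a b φ) (hp_top : p ≠ ∞) : ContinuousOn φ (Icc a b) := by
  obtain ⟨d, v, h1, -⟩ := h
  exact h1.continuousOn_Xp hp_top

theorem singleton (a : ℝ) (φ : ℝ → Xp j p) : SolvesOn j p A f a a φ := by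
  refine ⟨0, 0, IsE1Rep.singleton a _, ?_⟩
  simp

theorem glue (hac : a ≤ c) (hcb : c ≤ b) (h : SolvesOn j p A f a c φ)
    (h' : SolvesOn j p A f c b ψ) (heq : φ c = ψ c) :
    SolvesOn j p A f a b (fun t => if t ≤ c then φ t else ψ t) := by
  obtain ⟨d, v, h1, h2⟩ := h
  obtain ⟨d', v', h1', h2'⟩ := h'
  have hL : ∀ᵐ t ∂(volume.restrict (Icc a c)), t ≤ c := by
    filter_upwards [ae_restrict_mem measurableSet_Icc] with t ht using ht.2
  have hR : ∀ᵐ t ∂(volume.restrict (Icc c b)), ¬ t ≤ c := by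
    filter_upwards [ae_restrict_mem measurableSet_Icc,
      ae_restrict_of_ae (Measure.ae_ne volume c)] with t ht hne
    exact not_le.2 (lt_of_le_of_ne ht.1 hne.symm)
  refine ⟨fun t => if t ≤ c then d t else d' t, fun t => if t ≤ c then v t else v' t, ?_, ?_⟩
  · have e1 : IsE1Rep j p (Icc a c) (fun t => (if t ≤ c then φ t else ψ t).toX₀)
        (fun t => if t ≤ c then d t else d' t) (fun t => if t ≤ c then v t else v' t) := by
      refine h1.congr ?_ ?_ ?_
      · intro t ht
        simp only [if_pos ht.2]
      · filter_upwards [hL] with t ht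
        rw [if_pos ht]
      · filter_upwards [hL] with t ht
        rw [if_pos ht]
    have e2 : IsE1Rep j p (Icc c b) (fun t => (if t ≤ c then φ t else ψ t).toX₀)
        (fun t => if t ≤ c then d t else d' t) (fun t => if t ≤ c then v t else v' t) := by
      refine h1'.congr ?_ ?_ ?_
      · intro t ht
        by_cases htc : t ≤ c
        · simp only [if_pos htc]
          rw [le_antisymm htc ht.1, heq]
        · simp only [if_neg htc]
      · filter_upwards [hR] with t ht
        rw [if_neg ht]
      · filter_upwards [hR] with t ht
        rw [if_neg ht]
    rw [← Icc_union_Icc_eq_Icc hac hcb]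
    exact e1.glue (right_mem_Icc.2 hac) (left_mem_Icc.2 hcb) e2
  · rw [← Icc_union_Icc_eq_Icc hac hcb, ae_restrict_union_iff]
    constructor
    · filter_upwards [hL, h2] with t ht h3
      simpa only [if_pos ht] using h3
    · filter_upwards [hR, h2'] with t ht h3
      simpa only [if_neg ht] using h3

end SolvesOn

/-- A solution on `[a, b)` with finite `E₁` norm extends to a solution on `[a, b]`. -/
theorem exists_solvesOn_Icc_of_forall_lt (hj : Function.Injective j) (hab : a < b) {M : ℝ≥0∞}
    (hM : M < ∞)
    (h : ∀ τ ∈ Ico a b, ∃ (dφ : ℝ → X₀) (v : ℝ → X₁),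
      IsE1Rep j p (Icc a τ) (fun t => (φ t).toX₀) dφ v ∧
      (∀ᵐ t ∂(volume.restrict (Icc a τ)), dφ t + A t (φ t) (v t) = f t (φ t)) ∧
      repNorm p (Icc a τ) (fun t => (φ t).toX₀) dφ v ≤ M) :
    ∃ ψ, EqOn ψ φ (Ico a b) ∧ SolvesOn j p A f a b ψ := by
  -- The derivative and the `X₁`-valued version in `h` may vary with `τ`. Injectivity of `j` and the
  -- equation determine them almost everywhere, which gives one pair `D`, `V` valid for all `τ`.
  set V : ℝ → X₁ := fun t => Function.invFun j (φ t).toX₀ with hV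
  set D : ℝ → X₀ := fun t => f t (φ t) - A t (φ t) (V t) with hD
  have key : ∀ τ ∈ Ico a b, IsE1Rep j p (Icc a τ) (fun t => (φ t).toX₀) D V ∧
      repNorm p (Icc a τ) (fun t => (φ t).toX₀) D V ≤ M := by
    intro τ hτ
    obtain ⟨d, v, h1, h2, h3⟩ := h τ hτ
    have ev : v =ᵐ[volume.restrict (Icc a τ)] V := by
      filter_upwards [h1.embed_ae_eq] with t ht
      rw [hV]; simp only
      rw [← ht, Function.leftInverse_invFun hj]
    have ed : d =ᵐ[volume.restrict (Icc a τ)] D := by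
      filter_upwards [ev, h2] with t e1 e2
      rw [hD]; simp only
      rw [← e1, ← e2, add_sub_cancel_right]
    refine ⟨h1.congr (fun _ _ => rfl) ed ev, ?_⟩
    unfold repNorm
    rw [← eLpNorm_congr_ae ed, ← eLpNorm_congr_ae ev]
    exact h3
  obtain ⟨u', hu', hrep⟩ := exists_rep_Icc_of_forall_lt hab hM key
  have hfin : ∀ t ∈ Icc a b, traceENorm j p (u' t) < ∞ := fun t ht =>
    hrep.traceENorm_lt_top (by
      rw [hu' ⟨le_rfl, hab⟩]; exact (φ a).traceENorm_lt_top) ht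
  have heq : EqOn (fun t => Xp.ofX₀ j p (u' t)) φ (Ico a b) := fun t ht => by
    simp only [hu' ht, Xp.ofX₀_toX₀]
  refine ⟨_, heq, D, V, hrep.congr (fun t ht => (Xp.toX₀_ofX₀ (hfin t ht)).symm)
    (ae_eq_refl _) (ae_eq_refl _), ?_⟩
  filter_upwards [ae_restrict_mem measurableSet_Icc,
    ae_restrict_of_ae (Measure.ae_ne volume b)] with t ht hne
  have e : Xp.ofX₀ j p (u' t) = φ t := heq ⟨ht.1, lt_of_le_of_ne ht.2 hne⟩
  rw [e, hD]
  simp only [sub_add_cancel]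

variable {t₀ : ℝ} {u₀ : Xp j p} {T : ℝ≥0∞}

/-- If the maximal solution extends to a solution on `[t₀, b]`, then `b` lies in its interval of
existence. -/
theorem IsMaximalSolution.lt_of_isSolutionOn [CompleteSpace X₀] [CompleteSpace X₁]
    (h : Assumptions j p t₀ A f) (hj : Function.Injective j) (hp_top : p ≠ ∞)
    (hφ : IsMaximalSolution j p t₀ A f u₀ T φ) (hb : t₀ ≤ b)
    (hψ : IsSolutionOn j p t₀ A f u₀ b ψ)
    (heq : ∀ t, t₀ ≤ t → ENNReal.ofReal (t - t₀) < T → ψ t = φ t) :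
    ENNReal.ofReal (b - t₀) < T := by
  by_contra hT
  rw [not_lt] at hT
  -- Restart from `ψ b`: gluing yields a solution beyond `b` that still agrees with `φ`, which
  -- contradicts maximality if `T ≤ b - t₀`.
  obtain ⟨δ, hδ, χ, hχ, hsol⟩ := h.exists_local_solution hj hp_top hb (ψ b)
  obtain ⟨hψ0, hψs⟩ := hψ
  have hglue := SolvesOn.glue hb (by linarith) hψs hsol hχ.symm
  have hle := hφ.2 (ENNReal.ofReal (b + δ - t₀)) (fun t => if t ≤ b then ψ t else χ t) ?_ ?_
  · have h1 := hle.trans hT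
    rw [ENNReal.ofReal_le_ofReal_iff (by linarith)] at h1
    linarith
  · intro b' hb' hlt
    refine ⟨by simp only [if_pos hb]; exact hψ0, hglue.mono (Icc_subset_Icc_right ?_)⟩
    have := (ENNReal.ofReal_lt_ofReal_iff_of_nonneg (by linarith)).1 hlt
    linarith
  · intro t ht hlt
    have h1 := (ENNReal.ofReal_lt_ofReal_iff_of_nonneg (by linarith)).1 (hlt.trans_le hT)
    simp only [if_pos (show t ≤ b by linarith)]
    exact heq t ht hlt

/-- A constant curve trivially solves the problem on the one-point interval `[t₀, t₀]`; if `T` were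
zero, it would be an extension to which the continuation criterion applies. -/
theorem IsMaximalSolution.pos [CompleteSpace X₀] [CompleteSpace X₁]
    (h : Assumptions j p t₀ A f) (hj : Function.Injective j) (hp_top : p ≠ ∞)
    (hφ : IsMaximalSolution j p t₀ A f u₀ T φ) : 0 < T := by
  by_contra hT
  have hT0 : T = 0 := by simpa using hT
  have := hφ.lt_of_isSolutionOn h hj hp_top (b := t₀) (ψ := fun _ => u₀) le_rfl
    ⟨rfl, SolvesOn.singleton t₀ _⟩ (fun t _ hlt => by simp [hT0] at hlt)
  simp [hT0] at this

end MaxReg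

namespace MaxReg

variable {X₀ X₁ : Type*} [NormedAddCommGroup X₀] [NormedSpace ℝ X₀]
  [NormedAddCommGroup X₁] [NormedSpace ℝ X₁] {j : X₁ →L[ℝ] X₀} {p : ℝ≥0∞} [Fact (1 ≤ p)]

/-! ### Stability estimates near a given solution -/

/-- The absorption step of the stability estimate; cancelling `x / 2` requires `x` to be finite. -/
theorem le_two_mul_of_le_add_half {x a : ℝ≥0∞} (hx : x ≠ ∞) (h : x ≤ a + x / 2) :
    x ≤ 2 * a := by
  have h1 : x / 2 + x / 2 ≤ a + x / 2 := by rwa [ENNReal.add_halves]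
  have h2 : x / 2 ≤ a :=
    (ENNReal.add_le_add_iff_right (ENNReal.div_ne_top hx two_ne_zero)).1 h1
  calc x = 2 * (x / 2) := (ENNReal.mul_div_cancel two_ne_zero ENNReal.ofNat_ne_top).symm
    _ ≤ 2 * a := by gcongr

/-- Near every time `s`, the distance of a solution `ψ` of a perturbed problem to a given solution
`φ` is controlled by the size of the perturbation and the initial distance, as long as `ψ` stays
close to `φ`. No Lipschitz constants of the perturbed problem enter. -/
theorem Assumptions.exists_local_estimate [CompleteSpace X₀] [CompleteSpace X₁] {t₀ b R : ℝ}
    {A : ℝ → Xp j p → X₁ →L[ℝ] X₀} {f : ℝ → Xp j p → X₀} {φ : ℝ → Xp j p}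
    (h : Assumptions j p t₀ A f) (hj : Function.Injective j) (hp_top : p ≠ ∞)
    (hφ : SolvesOn j p A f t₀ b φ) (hR : ∀ t ∈ Icc t₀ b, ‖φ t‖ + 1 ≤ R) (hbR : b - t₀ ≤ R)
    {s : ℝ} (hs : s ∈ Icc t₀ b) :
    ∃ δ r : ℝ, 0 < δ ∧ 0 < r ∧ ∃ K M : NNReal,
      ∀ (A' : ℝ → Xp j p → X₁ →L[ℝ] X₀) (f' : ℝ → Xp j p → X₀) (ψ : ℝ → Xp j p) (s₁ s₂ ε : ℝ),
        t₀ ≤ s₁ → s₁ ≤ s₂ → s₂ ≤ b → s - δ < s₁ → s₂ < s + δ → 0 < ε → ε ≤ r →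
        (∀ t ∈ Icc t₀ b, ∀ u : Xp j p, ‖u‖ ≤ R → ‖f' t u - f t u‖ ≤ ε ∧ ‖A' t u - A t u‖ ≤ ε) →
        SolvesOn j p A' f' s₁ s₂ ψ → (∀ t ∈ Icc s₁ s₂, ‖ψ t - φ t‖ ≤ r) →
        e1Norm j p (Icc s₁ s₂) (fun t => (ψ t).toX₀ - (φ t).toX₀)
            ≤ K * (ENNReal.ofReal ε + ‖ψ s₁ - φ s₁‖ₑ) ∧
        (∀ t ∈ Icc s₁ s₂, ‖ψ t - φ t‖ₑ ≤ K * (ENNReal.ofReal ε + ‖ψ s₁ - φ s₁‖ₑ)) ∧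
        ∃ (dψ : ℝ → X₀) (v : ℝ → X₁), IsE1Rep j p (Icc s₁ s₂) (fun t => (ψ t).toX₀) dψ v ∧
          (∀ᵐ t ∂(volume.restrict (Icc s₁ s₂)), dψ t + A' t (ψ t) (v t) = f' t (ψ t)) ∧
          repNorm p (Icc s₁ s₂) (fun t => (ψ t).toX₀) dψ v
            ≤ M + K * (ENNReal.ofReal ε + ‖ψ s₁ - φ s₁‖ₑ) := by
  have hp := Fact.out (p := 1 ≤ p)
  have hφc := hφ.continuousOn hp_top
  obtain ⟨dφ, vφ, hφrep, hφeq⟩ := hφ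
  have htb : t₀ ≤ b := hs.1.trans hs.2
  have hR0 : 0 < R := lt_of_lt_of_le (by positivity) (hR s hs)
  obtain ⟨L, hL0, hL⟩ := h.lipschitz_A R hR0
  obtain ⟨Ψ, hΨm, hΨ⟩ := h.lipschitz_f R hR0
  set B := A s (φ s) with hB
  -- The endpoint `b + 1` keeps the interval nondegenerate when `b = t₀`. The constant covers all
  -- subintervals of `[t₀, b]`.
  obtain ⟨C, hC⟩ := exists_repNorm_le_of_maximalRegularity hj (show t₀ < b + 1 by linarith)
    (fun b' hb' => h.maximalRegularity s hs.1 (φ s) t₀ b' hb')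
  have hC0 : (0 : ℝ) ≤ C := C.2
  -- The terms to absorb are `c + L * c`, from `Ψ` and `vφ`, and `2 * c + L * c`, from `A' t (ψ t) -
  -- B` (perturbation, distance to `φ`, and variation of `A` along `φ`). Their sum is `c * (3 + 2 *
  -- L)`, which times `C` is at most `1 / 2`.
  set c : ℝ := 1 / (2 * (C + 1) * (3 + 2 * L)) with hc
  have hc0 : 0 < c := by positivity
  have hcC : C * (c * (3 + 2 * L)) ≤ 1 / 2 := by
    have : C * (c * (3 + 2 * L)) = C / (C + 1) * (1 / 2) := by rw [hc]; field_simp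
    rw [this]
    have h1 : (C : ℝ) / (C + 1) ≤ 1 := (div_le_one (by positivity)).2 (by linarith)
    linarith
  obtain ⟨δ₁, hδ₁, hδ₁'⟩ := Metric.continuousWithinAt_iff.1
    (h.continuousOn_along le_rfl hφc s hs) c hc0
  obtain ⟨δ₂, hδ₂, hδ₂'⟩ := exists_eLpNorm_Icc_le hp_top (hΨm b) hc0
  obtain ⟨δ₃, hδ₃, hδ₃'⟩ := exists_eLpNorm_Icc_le hp_top hφrep.memLp_dom hc0
  set P : ℝ≥0∞ := eLpNorm (fun _ => (1 : ℝ)) p (volume.restrict (Icc t₀ b))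
    + eLpNorm vφ p (volume.restrict (Icc t₀ b)) with hP
  have hPtop : P < ∞ := ENNReal.add_lt_top.2 ⟨(memLp_const (1 : ℝ)).2, hφrep.memLp_dom.2⟩
  set K : ℝ≥0∞ := 2 * (C * P + C * (1 + ‖B‖₊) + 1) with hK
  have hKtop : K ≠ ∞ := by
    have : (C : ℝ≥0∞) * P < ∞ := ENNReal.mul_lt_top ENNReal.coe_lt_top hPtop
    exact (ENNReal.mul_lt_top (by simp) (ENNReal.add_lt_top.2 ⟨ENNReal.add_lt_top.2 ⟨this,
      ENNReal.mul_lt_top ENNReal.coe_lt_top (by simp)⟩, by simp⟩)).ne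
  have hMtop := hφrep.repNorm_lt_top.ne
  -- The interval `[s₁, s₂]` lies within `δ` of `s` on both sides, so its length is below `2 * δ`;
  -- hence the halves. In the radius, `1` keeps `‖ψ t‖ ≤ R` and `c` limits the Lipschitz variation
  -- of `A`.
  refine ⟨min δ₁ (min (δ₂ / 2) (δ₃ / 2)), min c 1, by positivity, by positivity, K.toNNReal,
    (repNorm p (Icc t₀ b) (fun t => (φ t).toX₀) dφ vφ).toNNReal, ?_⟩
  rw [ENNReal.coe_toNNReal hKtop, ENNReal.coe_toNNReal hMtop]
  intro A' f' ψ s₁ s₂ ε hs₁ hs₁₂ hs₂ hδs₁ hδs₂ hε0 hεr hpert hψ hψφ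
  have hψc := hψ.continuousOn hp_top
  obtain ⟨dψ, vψ, hψrep, hψeq⟩ := hψ
  set δ := min δ₁ (min (δ₂ / 2) (δ₃ / 2)) with hδdef
  have hδδ₁ : δ ≤ δ₁ := min_le_left _ _
  have hδδ₂ : δ ≤ δ₂ / 2 := (min_le_right _ _).trans (min_le_left _ _)
  have hδδ₃ : δ ≤ δ₃ / 2 := (min_le_right _ _).trans (min_le_right _ _)
  set J := Icc s₁ s₂ with hJ
  set μ := volume.restrict J with hμ
  have hJsub : J ⊆ Icc t₀ b := Icc_subset_Icc hs₁ hs₂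
  have hs₁J : s₁ ∈ J := left_mem_Icc.2 hs₁₂
  have hεc : ε ≤ c := hεr.trans (min_le_left _ _)
  have hφJ := hφrep.mono hJsub
  have hφcJ := hφc.mono hJsub
  have hΨJ : eLpNorm Ψ p μ ≤ ENNReal.ofReal c := hδ₂' _ _ hJsub (by linarith)
  have hvJ : eLpNorm vφ p μ ≤ ENNReal.ofReal c := hδ₃' _ _ hJsub (by linarith)
  have hφR : ∀ t ∈ J, ‖φ t‖ ≤ R := fun t ht => by linarith [hR t (hJsub ht)]
  have hψR : ∀ t ∈ J, ‖ψ t‖ ≤ R := fun t ht => by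
    have h1 := norm_le_norm_add_norm_sub' (ψ t) (φ t)
    have h2 := (hψφ t ht).trans (min_le_right _ _)
    linarith [hR t (hJsub ht)]
  have hLJ : ∀ t ∈ J, ∀ u₁ u₂ : Xp j p, ‖u₁‖ ≤ R → ‖u₂‖ ≤ R → ∀ w : X₁,
      ‖A t u₁ w - A t u₂ w‖ ≤ L * ‖u₁ - u₂‖ * ‖w‖ := fun t ht =>
    hL t ⟨(hJsub ht).1, by linarith [(hJsub ht).2]⟩
  have hκ : ∀ t ∈ J, ‖A' t (ψ t) - B‖ ≤ 2 * c + L * c := by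
    intro t ht
    have h1 := (hpert t (hJsub ht) (ψ t) (hψR t ht)).2
    have h2 : ‖A t (ψ t) - A t (φ t)‖ ≤ L * c := by
      refine ContinuousLinearMap.opNorm_le_bound _ (by positivity) fun w => ?_
      refine (hLJ t ht _ _ (hψR t ht) (hφR t ht) w).trans ?_
      gcongr
      exact (hψφ t ht).trans (min_le_left _ _)
    have h3 : ‖A t (φ t) - B‖ ≤ c := by
      have := hδ₁' (hJsub ht) (by
        rw [Real.dist_eq, abs_lt]; constructor <;> linarith [ht.1, ht.2])
      rw [dist_eq_norm] at this
      exact this.le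
    have e : A' t (ψ t) - B = (A' t (ψ t) - A t (ψ t)) + (A t (ψ t) - A t (φ t))
      + (A t (φ t) - B) := by abel
    rw [e]
    refine (norm_add_le_of_le (norm_add_le_of_le h1 h2) h3).trans ?_
    linarith
  -- subtract an extension of the initial difference
  set y := ψ s₁ - φ s₁ with hy
  set E : ℝ≥0∞ := ENNReal.ofReal ε + ‖y‖ₑ with hE
  -- Strict because `ε > 0`; this provides an extension of `y` with norm below `E`, even when `y =
  -- 0`.
  have hyE : traceENorm j p y.toX₀ < E := by
    rw [← Xp.enorm_eq, hE, add_comm]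
    exact ENNReal.lt_add_right enorm_ne_top (ENNReal.ofReal_pos.2 hε0).ne'
  have hεE : ENNReal.ofReal ε ≤ E := le_self_add
  obtain ⟨G, dG, vG, hGs, hG, hGE⟩ := exists_extension hyE s₁
  have hGJ := hG.mono (J := J) fun _ ht => ht.1
  have hGJn : repNorm p J G dG vG ≤ repNorm p (Ici s₁) G dG vG :=
    repNorm_mono p (fun _ ht => ht.1) _ _ _
  have hz := hψrep.sub hφJ
  set ζ := ((fun t => (ψ t).toX₀) - fun t => (φ t).toX₀) - G with hζdef
  have hζ : IsE1Rep j p J ζ (dψ - dφ - dG) (vψ - vφ - vG) := hz.sub hGJ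
  have hζ0 : ζ s₁ = 0 := by simp [hζdef, hGs, hy]
  -- `X` dominates both the `X_p` distance of `ψ` and `φ` on `J` and the `E₁` norm of their
  -- difference.
  set X := repNorm p J ζ (dψ - dφ - dG) (vψ - vφ - vG) + repNorm p (Ici s₁) G dG vG with hX
  have hXtop : X ≠ ∞ := (ENNReal.add_lt_top.2 ⟨hζ.repNorm_lt_top, hG.repNorm_lt_top⟩).ne
  have hXz : ∀ t ∈ J, ‖ψ t - φ t‖ₑ ≤ X := by
    intro t ht
    have e : (ψ t - φ t).toX₀ = ζ t + G t := by simp [hζdef]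
    rw [Xp.enorm_eq, e]
    exact (traceENorm_add_le _ _).trans (add_le_add (hζ.traceENorm_le_of_left_eq_zero hζ0 ht)
      (hG.traceENorm_le_repNorm_Ici ht.1))
  have hXrep : repNorm p J ((fun t => (ψ t).toX₀) - fun t => (φ t).toX₀) (dψ - dφ) (vψ - vφ)
      ≤ X := by
    have a1 : eLpNorm ((fun t => (ψ t).toX₀) - fun t => (φ t).toX₀) p μ
        ≤ eLpNorm ζ p μ + eLpNorm G p μ := by
      have := eLpNorm_add_le hζ.memLp.1 hGJ.memLp.1 hp
      rwa [hζdef, sub_add_cancel] at this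
    have a2 : eLpNorm (dψ - dφ) p μ ≤ eLpNorm (dψ - dφ - dG) p μ + eLpNorm dG p μ := by
      have := eLpNorm_add_le hζ.memLp_deriv.1 hGJ.memLp_deriv.1 hp
      rwa [sub_add_cancel] at this
    have a3 : eLpNorm (vψ - vφ) p μ ≤ eLpNorm (vψ - vφ - vG) p μ + eLpNorm vG p μ := by
      have := eLpNorm_add_le hζ.memLp_dom.1 hGJ.memLp_dom.1 hp
      rwa [sub_add_cancel] at this
    refine le_trans ?_ (add_le_add le_rfl hGJn)
    unfold repNorm
    refine (add_le_add (add_le_add a1 a2) a3).trans (le_of_eq ?_)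
    ring
  have hXw : eLpNorm (vψ - vφ) p μ ≤ X := (eLpNorm_dom_le_repNorm _ _ _ _).trans hXrep
  have hH : eLpNorm (fun t => frozenRhs A' f' B ψ vψ t - frozenRhs A f B φ vφ t) p μ
      ≤ P * E + ENNReal.ofReal (c * (3 + 2 * L)) * X := by
    have h1 := h.eLpNorm_frozenRhs_sub_le (A := A') (f := f') (B := B) (φ := ψ) (φ' := φ)
      (v := vψ) (v' := vφ) (Z := X.toReal) (ε := ε) (κ := 2 * c + L * c) hs₁ hL0.le
      ENNReal.toReal_nonneg hε0.le (by positivity) hLJ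
      (memLp_restrict_mono (Icc_subset_Icc hs₁ hs₂) (hΨm b)) hΨ hψc hφcJ hψR hφR
      hψrep.memLp_dom hφJ.memLp_dom
      (fun t ht => Xp.norm_le_of_traceENorm_le ENNReal.toReal_nonneg (by
        rw [ENNReal.ofReal_toReal hXtop, ← Xp.enorm_eq]; exact hXz t ht))
      (fun t ht => (hpert t (hJsub ht) (ψ t) (hψR t ht)).1)
      (fun t ht => (hpert t (hJsub ht) (ψ t) (hψR t ht)).2) hκ
    rw [ENNReal.ofReal_toReal hXtop] at h1
    have hP' : eLpNorm (fun _ => (1 : ℝ)) p μ + eLpNorm vφ p μ ≤ P :=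
      add_le_add (eLpNorm_restrict_mono hJsub _) (eLpNorm_restrict_mono hJsub _)
    refine h1.trans ?_
    calc _ ≤ E * P + X * (ENNReal.ofReal c + ENNReal.ofReal L * ENNReal.ofReal c)
          + ENNReal.ofReal (2 * c + L * c) * X := by gcongr
      _ = P * E + ENNReal.ofReal (c * (3 + 2 * L)) * X := by
        rw [← ENNReal.ofReal_mul hL0.le, ← ENNReal.ofReal_add hc0.le (by positivity),
          mul_comm E P, mul_comm X, add_assoc, ← add_mul,
          ← ENNReal.ofReal_add (by positivity) (by positivity)]
        congr 3
        ring
  have hrhs : eLpNorm (fun t => (dψ - dφ - dG) t + B ((vψ - vφ - vG) t)) p μ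
      ≤ P * E + ENNReal.ofReal (c * (3 + 2 * L)) * X + (1 + ‖B‖₊) * E := by
    have e : (fun t => (dψ - dφ - dG) t + B ((vψ - vφ - vG) t)) =ᵐ[μ]
        (fun t => frozenRhs A' f' B ψ vψ t - frozenRhs A f B φ vφ t)
          - (dG + fun t => B (vG t)) := by
      filter_upwards [hψeq, ae_restrict_of_ae_restrict_of_subset hJsub hφeq] with t h1 h2
      simp only [frozenRhs, Pi.sub_apply, Pi.add_apply, map_sub, sub_apply, ← h1, ← h2]
      abel
    have mH : AEStronglyMeasurable
        (fun t => frozenRhs A' f' B ψ vψ t - frozenRhs A f B φ vφ t) μ := by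
      have : MemLp (fun t => (dψ - dφ) t + B ((vψ - vφ) t)) p μ :=
        hz.memLp_deriv.add (B.comp_memLp' hz.memLp_dom)
      refine this.1.congr ?_
      filter_upwards [hψeq, ae_restrict_of_ae_restrict_of_subset hJsub hφeq] with t h1 h2
      simp only [frozenRhs, Pi.sub_apply, map_sub, sub_apply, ← h1, ← h2]
      abel
    have mB : MemLp (fun t => B (vG t)) p μ := B.comp_memLp' hGJ.memLp_dom
    rw [eLpNorm_congr_ae e]
    refine (eLpNorm_sub_le mH (hGJ.memLp_deriv.add mB).1 hp).trans (add_le_add hH ?_)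
    refine (eLpNorm_add_le hGJ.memLp_deriv.1 mB.1 hp).trans ?_
    have b1 : eLpNorm dG p μ ≤ E := (eLpNorm_deriv_le_repNorm _ _ _ _).trans (hGJn.trans hGE.le)
    have b2 : eLpNorm (fun t => B (vG t)) p μ ≤ ‖B‖₊ * E := by
      refine (eLpNorm_le_mul_eLpNorm_of_ae_le_mul' (c := ‖B‖₊) (g := vG)
        (Eventually.of_forall fun t => B.le_opENorm (vG t)) p).trans ?_
      gcongr
      exact (eLpNorm_dom_le_repNorm _ _ _ _).trans (hGJn.trans hGE.le)
    rw [add_mul, one_mul]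
    exact add_le_add b1 b2
  -- Maximal regularity of `B` applied to `ζ`, which vanishes at `s₁`; the terms containing `X` on
  -- the right add up to at most `X / 2`.
  have hXK : X ≤ K * E := by
    have h1 := hC s₁ s₂ hs₁ hs₁₂ (by linarith) _ _ _ hζ hζ0
    have h2 : (C : ℝ≥0∞) * (ENNReal.ofReal (c * (3 + 2 * L)) * X) ≤ X / 2 := by
      have : (C : ℝ≥0∞) = ENNReal.ofReal C := by simp
      rw [← mul_assoc, this, ← ENNReal.ofReal_mul hC0, ENNReal.div_eq_inv_mul]
      gcongr
      refine (ENNReal.ofReal_le_ofReal hcC).trans (le_of_eq ?_)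
      rw [one_div, ENNReal.ofReal_inv_of_pos two_pos]
      simp
    have h3 : X ≤ (C * P + C * (1 + ‖B‖₊) + 1) * E + X / 2 := by
      calc X ≤ C * (P * E + ENNReal.ofReal (c * (3 + 2 * L)) * X + (1 + ‖B‖₊) * E) + E :=
            add_le_add (h1.trans (by gcongr)) hGE.le
        _ = C * P * E + C * (ENNReal.ofReal (c * (3 + 2 * L)) * X) + C * (1 + ‖B‖₊) * E + E := by
            ring
        _ ≤ C * P * E + X / 2 + C * (1 + ‖B‖₊) * E + E := by gcongr
        _ = _ := by ring
    refine (le_two_mul_of_le_add_half hXtop h3).trans (le_of_eq ?_)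
    rw [hK, mul_assoc]
  refine ⟨(e1Norm_le_repNorm hz).trans (hXrep.trans hXK), fun t ht => (hXz t ht).trans hXK,
    dψ, vψ, hψrep, hψeq, ?_⟩
  refine le_trans ?_ (add_le_add (repNorm_mono p hJsub _ _ _) (hXrep.trans hXK))
  have a1 : eLpNorm (fun t => (ψ t).toX₀) p μ ≤ eLpNorm (fun t => (φ t).toX₀) p μ
      + eLpNorm ((fun t => (ψ t).toX₀) - fun t => (φ t).toX₀) p μ := by
    have := eLpNorm_add_le hφJ.memLp.1 hz.memLp.1 hp
    rwa [add_sub_cancel] at this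
  have a2 : eLpNorm dψ p μ ≤ eLpNorm dφ p μ + eLpNorm (dψ - dφ) p μ := by
    have := eLpNorm_add_le hφJ.memLp_deriv.1 hz.memLp_deriv.1 hp
    rwa [add_sub_cancel] at this
  have a3 : eLpNorm vψ p μ ≤ eLpNorm vφ p μ + eLpNorm (vψ - vφ) p μ := by
    have := eLpNorm_add_le hφJ.memLp_dom.1 hz.memLp_dom.1 hp
    rwa [add_sub_cancel] at this
  unfold repNorm
  refine (add_le_add (add_le_add a1 a2) a3).trans (le_of_eq ?_)
  ring

end MaxReg

/-! ### Propagation along compact intervals -/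

namespace MaxReg

/-- Induction along a compact interval: a property that propagates forward near every point of
`[a, b]` passes from `a` to `b`. -/
theorem Icc_induction {a b : ℝ} (hab : a ≤ b) {P : ℝ → Prop} (h0 : P a)
    (hstep : ∀ s ∈ Icc a b, ∃ δ : ℝ, 0 < δ ∧ ∀ s₁ s₂, a ≤ s₁ → s₁ ≤ s₂ → s₂ ≤ b →
      s - δ < s₁ → s₂ < s + δ → P s₁ → P s₂) : P b := by
  choose δ hδ hprop using hstep
  -- By compactness a finite subdivision has each step inside one of the neighbourhoods; the
  -- sequence `τ` is equal to `b` from the index `m` on.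
  obtain ⟨τ, hτ0, hτmono, ⟨m, hm⟩, hτsub⟩ := exists_monotone_Icc_subset_open_cover_Icc hab
    (c := fun s : Icc a b => {x : Icc a b | (s : ℝ) - δ s s.2 < x ∧ (x : ℝ) < s + δ s s.2})
    (fun s => (isOpen_lt continuous_const continuous_subtype_val).inter
      (isOpen_lt continuous_subtype_val continuous_const))
    (fun s _ => mem_iUnion.2 ⟨s, by
      have := hδ s s.2
      constructor <;> linarith⟩)
  have hind : ∀ k, P (τ k) := by
    intro k
    induction k with
    | zero => rwa [hτ0]
    | succ k ih =>
      obtain ⟨s, hsub⟩ := hτsub k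
      have hle : τ k ≤ τ (k + 1) := hτmono k.le_succ
      exact hprop s s.2 (τ k) (τ (k + 1)) (τ k).2.1 hle (τ (k + 1)).2.2
        (hsub (left_mem_Icc.2 hle)).1 (hsub (right_mem_Icc.2 hle)).2 ih
  have := hind m
  rwa [hm m le_rfl] at this

theorem e1Norm_mono {X₀ X₁ : Type*} [NormedAddCommGroup X₀] [NormedSpace ℝ X₀]
    [NormedAddCommGroup X₁] [NormedSpace ℝ X₁] {j : X₁ →L[ℝ] X₀} {p : ℝ≥0∞} {I J : Set ℝ} (hJ : J ⊆ I) (u : ℝ → X₀) :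
    e1Norm j p J u ≤ e1Norm j p I u := by
  refine le_iInf fun du => le_iInf fun v => le_iInf fun h => ?_
  exact (e1Norm_le_repNorm (h.mono hJ)).trans (repNorm_mono p hJ u du v)

theorem e1Norm_singleton {X₀ X₁ : Type*} [NormedAddCommGroup X₀] [NormedSpace ℝ X₀]
    [NormedAddCommGroup X₁] [NormedSpace ℝ X₁] {j : X₁ →L[ℝ] X₀} {p : ℝ≥0∞} (a : ℝ) (u : ℝ → X₀) :
    e1Norm j p (Icc a a) u = 0 := by
  refine le_antisymm ((e1Norm_le_repNorm (IsE1Rep.singleton a u)).trans ?_) bot_le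
  simp [repNorm]

variable {X₀ X₁ : Type*} [NormedAddCommGroup X₀] [NormedSpace ℝ X₀]
  [NormedAddCommGroup X₁] [NormedSpace ℝ X₁] {j : X₁ →L[ℝ] X₀} {p : ℝ≥0∞} [Fact (1 ≤ p)]

/-! ### Continuous dependence -/

theorem IsSolutionOn.solvesOn {t₀ b : ℝ} {A : ℝ → Xp j p → X₁ →L[ℝ] X₀} {f : ℝ → Xp j p → X₀}
    {u₀ : Xp j p} {φ : ℝ → Xp j p} (h : IsSolutionOn j p t₀ A f u₀ b φ) :
    SolvesOn j p A f t₀ b φ := h.2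

/-- A maximal solution that is bounded in `E₁` and improves on the bound `‖ψ - φ‖ ≤ r` as long as
this bound holds, exists on all of `[t₀, s₂]` and satisfies the bound. -/
theorem IsMaximalSolution.bootstrap [CompleteSpace X₀] [CompleteSpace X₁] {t₀ s₁ s₂ r : ℝ}
    {A : ℝ → Xp j p → X₁ →L[ℝ] X₀} {f : ℝ → Xp j p → X₀} {u₀ : Xp j p} {T : ℝ≥0∞}
    {φ ψ : ℝ → Xp j p} (h : Assumptions j p t₀ A f) (hj : Function.Injective j) (hp_top : p ≠ ∞)
    (hψ : IsMaximalSolution j p t₀ A f u₀ T ψ) (hφ : ContinuousOn φ (Icc s₁ s₂))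
    (hs₁ : t₀ ≤ s₁) (hs₁₂ : s₁ ≤ s₂) (hr : 0 < r) (hT : ENNReal.ofReal (s₁ - t₀) < T)
    (hinit : ‖ψ s₁ - φ s₁‖ ≤ r) {M : ℝ≥0∞} (hM : M < ∞)
    (hest : ∀ τ ∈ Icc s₁ s₂, SolvesOn j p A f s₁ τ ψ → (∀ t ∈ Icc s₁ τ, ‖ψ t - φ t‖ ≤ r) →
      (∀ t ∈ Icc s₁ τ, ‖ψ t - φ t‖ ≤ r / 2) ∧
      ∃ (dψ : ℝ → X₀) (v : ℝ → X₁), IsE1Rep j p (Icc s₁ τ) (fun t => (ψ t).toX₀) dψ v ∧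
        (∀ᵐ t ∂(volume.restrict (Icc s₁ τ)), dψ t + A t (ψ t) (v t) = f t (ψ t)) ∧
        repNorm p (Icc s₁ τ) (fun t => (ψ t).toX₀) dψ v ≤ M) :
    ENNReal.ofReal (s₂ - t₀) < T ∧ ∀ t ∈ Icc s₁ s₂, ‖ψ t - φ t‖ ≤ r := by
  -- Continuity method: the supremum `σ` of the times up to which `ψ` exists and stays within `r` of
  -- `φ` belongs to `S`, and it cannot be smaller than `s₂`.
  set S : Set ℝ := {τ | τ ∈ Icc s₁ s₂ ∧ ENNReal.ofReal (τ - t₀) < T ∧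
    ∀ t ∈ Icc s₁ τ, ‖ψ t - φ t‖ ≤ r} with hS
  have hsolve : ∀ τ, s₁ ≤ τ → ENNReal.ofReal (τ - t₀) < T → SolvesOn j p A f s₁ τ ψ :=
    fun τ hτ hlt => (hψ.1 τ (hs₁.trans hτ) hlt).solvesOn.mono (Icc_subset_Icc_left hs₁)
  have hs₁S : s₁ ∈ S := by
    refine ⟨left_mem_Icc.2 hs₁₂, hT, fun t ht => ?_⟩
    rw [Icc_self, mem_singleton_iff] at ht
    rwa [ht]
  have hbdd : BddAbove S := ⟨s₂, fun τ hτ => hτ.1.2⟩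
  set σ := sSup S with hσ
  have hσ₁ : s₁ ≤ σ := le_csSup hbdd hs₁S
  have hσ₂ : σ ≤ s₂ := csSup_le ⟨s₁, hs₁S⟩ fun τ hτ => hτ.1.2
  have hlow : ∀ τ ∈ Ico s₁ σ, τ ∈ S := by
    intro τ hτ
    obtain ⟨τ', hτ', hlt⟩ := exists_lt_of_lt_csSup ⟨s₁, hs₁S⟩ hτ.2
    exact ⟨⟨hτ.1, hτ.2.le.trans hσ₂⟩,
      (ENNReal.ofReal_le_ofReal (by linarith)).trans_lt hτ'.2.1,
      fun t ht => hτ'.2.2 t ⟨ht.1, ht.2.trans hlt.le⟩⟩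
  have hσT : ENNReal.ofReal (σ - t₀) < T := by
    rcases hσ₁.eq_or_lt with heq | hlt
    · rwa [← heq]
    -- If existence ended by `σ`, the `E₁` bound `M` on all `[s₁, τ]` with `τ < σ` would extend `ψ`
    -- to `σ`, which the continuation criterion forbids.
    by_contra hcon
    obtain ⟨χ, hχ, hχs⟩ := exists_solvesOn_Icc_of_forall_lt (φ := ψ) (A := A) (f := f) hj hlt hM
      (fun τ hτ => (hest τ (hlow τ hτ).1 (hsolve τ hτ.1 (hlow τ hτ).2.1) (hlow τ hτ).2.2).2)
    have hglue := SolvesOn.glue hs₁ hσ₁ (hψ.1 s₁ hs₁ hT).2 hχs (hχ ⟨le_rfl, hlt⟩).symm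
    refine hcon (hψ.lt_of_isSolutionOn h hj hp_top (hs₁.trans hσ₁)
      ⟨by simp only [if_pos hs₁]; exact (hψ.1 s₁ hs₁ hT).1, hglue⟩ fun t ht htT => ?_)
    by_cases hts : t ≤ s₁
    · simp only [if_pos hts]
    · simp only [if_neg hts]
      refine hχ ⟨(not_le.1 hts).le, ?_⟩
      by_contra hge
      exact hcon ((ENNReal.ofReal_le_ofReal (by linarith)).trans_lt htT)
  have hcont : ∀ τ, s₁ ≤ τ → τ ≤ s₂ → ENNReal.ofReal (τ - t₀) < T →
      ContinuousOn (fun t => ‖ψ t - φ t‖) (Icc s₁ τ) := fun τ hτ₁ hτ₂ hlt =>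
    (((hsolve τ hτ₁ hlt).continuousOn hp_top).sub (hφ.mono (Icc_subset_Icc_right hτ₂))).norm
  have hσS : σ ∈ S := by
    refine ⟨⟨hσ₁, hσ₂⟩, hσT, fun t ht => ?_⟩
    rcases ht.2.lt_or_eq with hlt | rfl
    · exact (hlow t ⟨ht.1, hlt⟩).2.2 t (right_mem_Icc.2 ht.1)
    rcases hσ₁.eq_or_lt with heq | hlt
    · rwa [← heq]
    have hc := (hcont _ hσ₁ hσ₂ hσT) _ (right_mem_Icc.2 hσ₁)
    have hc' : Tendsto (fun t => ‖ψ t - φ t‖) (𝓝[<] (sSup S)) (𝓝 ‖ψ (sSup S) - φ (sSup S)‖) :=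
      hc.tendsto.mono_left (nhdsWithin_le_of_mem (Icc_mem_nhdsLT hlt))
    refine le_of_tendsto hc' ?_
    filter_upwards [Ico_mem_nhdsLT hlt] with t ht'
    exact (hlow t ht').2.2 t (right_mem_Icc.2 ht'.1)
  rcases hσ₂.eq_or_lt with heq | hlt
  · rw [heq] at hσS
    exact hσS.2
  exfalso
  obtain ⟨τ, hστ, hτ₂, hτT⟩ : ∃ τ, σ < τ ∧ τ ≤ s₂ ∧ ENNReal.ofReal (τ - t₀) < T := by
    have hc : Tendsto (fun τ : ℝ => ENNReal.ofReal (τ - t₀)) (𝓝[>] σ)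
        (𝓝 (ENNReal.ofReal (σ - t₀))) :=
      ((ENNReal.continuous_ofReal.comp (continuous_id.sub continuous_const)).tendsto σ).mono_left
        nhdsWithin_le_nhds
    obtain ⟨τ, h1, h2⟩ := ((hc.eventually_lt_const hσT).and (Ioc_mem_nhdsGT hlt)).exists
    exact ⟨τ, h2.1, h2.2, h1⟩
  -- At `σ` the distance is at most `r / 2 < r`, so by continuity the bound `r` persists slightly
  -- beyond `σ`.
  have hhalf := (hest σ ⟨hσ₁, hσ₂⟩ (hsolve σ hσ₁ hσT) hσS.2.2).1
  have hc := (hcont τ (hσ₁.trans hστ.le) hτ₂ hτT) σ ⟨hσ₁, hστ.le⟩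
  have hc' : Tendsto (fun t => ‖ψ t - φ t‖) (𝓝[>] σ) (𝓝 ‖ψ σ - φ σ‖) :=
    hc.tendsto.mono_left (nhdsWithin_le_of_mem (by
      filter_upwards [Ioc_mem_nhdsGT hστ] with t ht using ⟨hσ₁.trans ht.1.le, ht.2⟩))
  have hev := hc'.eventually_lt_const
    (show ‖ψ σ - φ σ‖ < r by linarith [hhalf σ (right_mem_Icc.2 hσ₁)])
  obtain ⟨d, hd, hdsub⟩ := mem_nhdsGT_iff_exists_Ioc_subset.1 hev
  have hd' : σ < d := hd
  have hm : σ < min d τ := lt_min hd' hστ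
  have hmem : min d τ ∈ S := by
    refine ⟨⟨hσ₁.trans hm.le, (min_le_right _ _).trans hτ₂⟩,
      (ENNReal.ofReal_le_ofReal (by linarith [min_le_right d τ])).trans_lt hτT, fun t ht => ?_⟩
    rcases le_or_gt t σ with htσ | htσ
    · exact hσS.2.2 t ⟨ht.1, htσ⟩
    · exact (hdsub ⟨htσ, ht.2.trans (min_le_left _ _)⟩ : ‖ψ t - φ t‖ < r).le
  exact absurd (le_csSup hbdd hmem) (not_le.2 hm)

/-- Needed to add up convergence over successive intervals. The two infima on the right involve
unrelated derivatives and `X₁`-valued versions; these are spliced at `b`, which is a null set. -/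
theorem e1Norm_Icc_le_add {a b c : ℝ} (hab : a ≤ b) (hbc : b ≤ c) (u : ℝ → X₀) :
    e1Norm j p (Icc a c) u ≤ e1Norm j p (Icc a b) u + e1Norm j p (Icc b c) u := by
  conv_rhs => unfold e1Norm
  simp only [ENNReal.iInf_add, ENNReal.add_iInf]
  refine le_iInf fun d' => le_iInf fun v' => le_iInf fun h' => le_iInf fun d => le_iInf fun v =>
    le_iInf fun h => ?_
  set D : ℝ → X₀ := fun t => if t ≤ b then d t else d' t with hD
  set V : ℝ → X₁ := fun t => if t ≤ b then v t else v' t with hV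
  have hL : ∀ᵐ t ∂(volume.restrict (Icc a b)), t ≤ b := by
    filter_upwards [ae_restrict_mem measurableSet_Icc] with t ht using ht.2
  have hR : ∀ᵐ t ∂(volume.restrict (Icc b c)), ¬ t ≤ b := by
    filter_upwards [ae_restrict_mem measurableSet_Icc,
      ae_restrict_of_ae (Measure.ae_ne volume b)] with t ht hne
    exact not_le.2 (lt_of_le_of_ne ht.1 hne.symm)
  have ed : d =ᵐ[volume.restrict (Icc a b)] D := hL.mono fun t ht => (if_pos ht).symm
  have ev : v =ᵐ[volume.restrict (Icc a b)] V := hL.mono fun t ht => (if_pos ht).symm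
  have ed' : d' =ᵐ[volume.restrict (Icc b c)] D := hR.mono fun t ht => (if_neg ht).symm
  have ev' : v' =ᵐ[volume.restrict (Icc b c)] V := hR.mono fun t ht => (if_neg ht).symm
  have h1 := h.congr (fun _ _ => rfl) ed ev
  have h2 := h'.congr (fun _ _ => rfl) ed' ev'
  have h3 := h1.glue (right_mem_Icc.2 hab) (left_mem_Icc.2 hbc) h2
  have h4 := h1.repNorm_union_le h2
  rw [Icc_union_Icc_eq_Icc hab hbc] at h3 h4
  refine (e1Norm_le_repNorm h3).trans (h4.trans (le_of_eq ?_))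
  unfold repNorm
  rw [eLpNorm_congr_ae ed, eLpNorm_congr_ae ev, eLpNorm_congr_ae ed', eLpNorm_congr_ae ev']

/-- Near every time `s` in the interval of existence of the limit solution, convergence at one time
propagates to later times. -/
theorem exists_propagation [CompleteSpace X₀] [CompleteSpace X₁] {t₀ b : ℝ}
    (hj : Function.Injective j) (hp_top : p ≠ ∞)
    {A : ℕ → ℝ → Xp j p → X₁ →L[ℝ] X₀} {f : ℕ → ℝ → Xp j p → X₀}
    {A' : ℝ → Xp j p → X₁ →L[ℝ] X₀} {f' : ℝ → Xp j p → X₀}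
    (hAf : ∀ n, Assumptions j p t₀ (A n) (f n)) (hAf' : Assumptions j p t₀ A' f')
    (hconv : ∀ ε η : ℝ, 0 < ε → 0 < η → ∀ᶠ n in atTop, ∀ t ∈ Icc t₀ b, ∀ u : Xp j p, ‖u‖ ≤ η →
      ‖f n t u - f' t u‖ ≤ ε ∧ ‖A n t u - A' t u‖ ≤ ε)
    {u₀ : ℕ → Xp j p} {T : ℕ → ℝ≥0∞} {ψ : ℕ → ℝ → Xp j p} {φ : ℝ → Xp j p}
    (hψ : ∀ n, IsMaximalSolution j p t₀ (A n) (f n) (u₀ n) (T n) (ψ n))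
    (hφ : SolvesOn j p A' f' t₀ b φ) {s : ℝ} (hs : s ∈ Icc t₀ b) :
    ∃ δ : ℝ, 0 < δ ∧ ∀ s₁ s₂, t₀ ≤ s₁ → s₁ ≤ s₂ → s₂ ≤ b → s - δ < s₁ → s₂ < s + δ →
      (∀ᶠ n in atTop, ENNReal.ofReal (s₁ - t₀) < T n) →
      Tendsto (fun n => ‖ψ n s₁ - φ s₁‖ₑ) atTop (𝓝 0) →
      (∀ᶠ n in atTop, ENNReal.ofReal (s₂ - t₀) < T n) ∧
      Tendsto (fun n => ‖ψ n s₂ - φ s₂‖ₑ) atTop (𝓝 0) ∧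
      Tendsto (fun n => e1Norm j p (Icc s₁ s₂) fun t => (ψ n t).toX₀ - (φ t).toX₀)
        atTop (𝓝 0) := by
  have hφc := hφ.continuousOn hp_top
  obtain ⟨R₀, hR₀, hR₀'⟩ := exists_norm_le_on_Icc hφc
  set R := max (R₀ + 1) (b - t₀) with hR
  have hRpos : 0 < R := lt_max_of_lt_left (by linarith)
  obtain ⟨δ, r, hδ, hr, K, M, hest⟩ := hAf'.exists_local_estimate hj hp_top hφ (R := R)
    (fun t ht => le_trans (by linarith [hR₀' t ht]) (le_max_left _ _)) (le_max_right _ _) hs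
  refine ⟨δ, hδ, fun s₁ s₂ hs₁ hs₁₂ hs₂ hδ₁ hδ₂ hT hlim => ?_⟩
  have key : ∀ θ : ℝ≥0∞, 0 < θ → θ ≤ ENNReal.ofReal (r / 2) → ∀ᶠ n in atTop,
      ENNReal.ofReal (s₂ - t₀) < T n ∧ ‖ψ n s₂ - φ s₂‖ₑ ≤ θ ∧
      e1Norm j p (Icc s₁ s₂) (fun t => (ψ n t).toX₀ - (φ t).toX₀) ≤ θ := by
    intro θ hθ hθr
    -- For large `n` both the perturbation and the initial distance are at most `ε`, so the local
    -- estimate yields `θ`. The restriction `θ ≤ r / 2` supplies the improved bound that the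
    -- continuity argument requires.
    obtain ⟨ε, hε0, hεr, hεθ⟩ : ∃ ε : ℝ, 0 < ε ∧ ε ≤ r ∧
        (K : ℝ≥0∞) * (ENNReal.ofReal ε + ENNReal.ofReal ε) ≤ θ := by
      have hc : Tendsto (fun ε : ℝ => (K : ℝ≥0∞) * (ENNReal.ofReal ε + ENNReal.ofReal ε))
          (𝓝[>] 0) (𝓝 0) := by
        have h0 : Tendsto (fun ε : ℝ => ENNReal.ofReal ε) (𝓝[>] 0) (𝓝 0) :=
          (ENNReal.continuous_ofReal.tendsto' 0 0 (by simp)).mono_left nhdsWithin_le_nhds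
        simpa using ENNReal.Tendsto.const_mul (h0.add h0) (Or.inr ENNReal.coe_ne_top)
      obtain ⟨ε, h1, h2⟩ := ((hc.eventually_le_const hθ).and (Ioc_mem_nhdsGT hr)).exists
      exact ⟨ε, h2.1, h2.2, h1⟩
    filter_upwards [hT, hconv ε R hε0 hRpos,
      hlim.eventually_le_const (ENNReal.ofReal_pos.2 hε0)] with n hTn hcn hyn
    have hKθ : (K : ℝ≥0∞) * (ENNReal.ofReal ε + ‖ψ n s₁ - φ s₁‖ₑ) ≤ θ :=
      le_trans (by gcongr) hεθ
    have hinit : ‖ψ n s₁ - φ s₁‖ ≤ r := by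
      rw [← ofReal_norm, ENNReal.ofReal_le_ofReal_iff hε0.le] at hyn
      exact hyn.trans hεr
    have hest' := fun τ (hτ : τ ∈ Icc s₁ s₂) => hest (A n) (f n) (ψ n) s₁ τ ε hs₁ hτ.1
      (hτ.2.trans hs₂) hδ₁ (hτ.2.trans_lt hδ₂) hε0 hεr hcn
    obtain ⟨h1, h2⟩ := (hψ n).bootstrap (hAf n) hj hp_top
      (hφc.mono (Icc_subset_Icc hs₁ hs₂)) hs₁ hs₁₂ hr hTn hinit
      (M := M + θ) (ENNReal.add_lt_top.2 ⟨ENNReal.coe_lt_top, hθr.trans_lt ENNReal.ofReal_lt_top⟩)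
      (fun τ hτ hsol hle => by
        obtain ⟨-, h1, d, v, h2, h3, h4⟩ := hest' τ hτ hsol hle
        refine ⟨fun t ht => ?_, d, v, h2, h3, h4.trans (by gcongr)⟩
        have := (h1 t ht).trans (hKθ.trans hθr)
        rwa [← ofReal_norm, ENNReal.ofReal_le_ofReal_iff (half_pos hr).le] at this)
    have hsol : SolvesOn j p (A n) (f n) s₁ s₂ (ψ n) :=
      ((hψ n).1 s₂ (hs₁.trans hs₁₂) h1).solvesOn.mono (Icc_subset_Icc_left hs₁)
    obtain ⟨h3, h4, -⟩ := hest' s₂ (right_mem_Icc.2 hs₁₂) hsol h2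
    exact ⟨h1, (h4 s₂ (right_mem_Icc.2 hs₁₂)).trans hKθ, h3.trans hKθ⟩
  have hr2 : 0 < ENNReal.ofReal (r / 2) := ENNReal.ofReal_pos.2 (half_pos hr)
  refine ⟨(key _ hr2 le_rfl).mono fun n hn => hn.1, ?_, ?_⟩
  · refine ENNReal.tendsto_nhds_zero.2 fun θ hθ => ?_
    exact (key (min θ (ENNReal.ofReal (r / 2))) (lt_min hθ hr2) (min_le_right _ _)).mono
      fun n hn => hn.2.1.trans (min_le_left _ _)
  · refine ENNReal.tendsto_nhds_zero.2 fun θ hθ => ?_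
    exact (key (min θ (ENNReal.ofReal (r / 2))) (lt_min hθ hr2) (min_le_right _ _)).mono
      fun n hn => hn.2.2.trans (min_le_left _ _)

theorem tendsto_e1Norm_of_isMaximalSolution [CompleteSpace X₀] [CompleteSpace X₁] {t₀ b : ℝ}
    (hj : Function.Injective j) (hp_top : p ≠ ∞) (hb : t₀ ≤ b)
    {A : ℕ → ℝ → Xp j p → X₁ →L[ℝ] X₀} {f : ℕ → ℝ → Xp j p → X₀}
    {A' : ℝ → Xp j p → X₁ →L[ℝ] X₀} {f' : ℝ → Xp j p → X₀}
    (hAf : ∀ n, Assumptions j p t₀ (A n) (f n)) (hAf' : Assumptions j p t₀ A' f')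
    (hconv : ∀ ε η : ℝ, 0 < ε → 0 < η → ∀ᶠ n in atTop, ∀ t ∈ Icc t₀ b, ∀ u : Xp j p, ‖u‖ ≤ η →
      ‖f n t u - f' t u‖ ≤ ε ∧ ‖A n t u - A' t u‖ ≤ ε)
    {u₀ : ℕ → Xp j p} {u₀' : Xp j p} {T : ℕ → ℝ≥0∞} {ψ : ℕ → ℝ → Xp j p} {φ : ℝ → Xp j p}
    (hu₀ : Tendsto (fun n => ‖u₀ n - u₀'‖) atTop (𝓝 0))
    (hψ : ∀ n, IsMaximalSolution j p t₀ (A n) (f n) (u₀ n) (T n) (ψ n))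
    (hφ : IsSolutionOn j p t₀ A' f' u₀' b φ) :
    (∀ᶠ n in atTop, ENNReal.ofReal (b - t₀) < T n) ∧
      Tendsto (fun n => e1Norm j p (Icc t₀ b) fun t => (ψ n t).toX₀ - (φ t).toX₀)
        atTop (𝓝 0) := by
  have hpos : ∀ n, ENNReal.ofReal (t₀ - t₀) < T n := fun n => by
    rw [sub_self, ENNReal.ofReal_zero]
    exact (hψ n).pos (hAf n) hj hp_top
  have hval : ∀ n, ψ n t₀ = u₀ n := fun n => ((hψ n).1 t₀ le_rfl (hpos n)).1
  have hstart : Tendsto (fun n => ‖ψ n t₀ - φ t₀‖ₑ) atTop (𝓝 0) := by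
    have := (ENNReal.continuous_ofReal.tendsto 0).comp hu₀
    rw [ENNReal.ofReal_zero] at this
    refine this.congr fun n => ?_
    rw [hval, hφ.1, Function.comp_apply, ofReal_norm]
  -- Existence and `X_p` convergence at `s` are what the next step starts from; the convergence of
  -- the `E₁` norm on `[t₀, s]` is accumulated along the way.
  have hend := Icc_induction hb (P := fun s => (∀ᶠ n in atTop, ENNReal.ofReal (s - t₀) < T n) ∧
      Tendsto (fun n => ‖ψ n s - φ s‖ₑ) atTop (𝓝 0) ∧
      Tendsto (fun n => e1Norm j p (Icc t₀ s) fun t => (ψ n t).toX₀ - (φ t).toX₀) atTop (𝓝 0))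
    ⟨Eventually.of_forall hpos, hstart, by simp only [e1Norm_singleton, tendsto_const_nhds]⟩
    (fun s hs => by
      obtain ⟨δ, hδ, hprop⟩ := exists_propagation hj hp_top hAf hAf' hconv hψ hφ.solvesOn hs
      refine ⟨δ, hδ, fun s₁ s₂ hs₁ hs₁₂ hs₂ h1 h2 ih => ?_⟩
      obtain ⟨e1, e2, e3⟩ := hprop s₁ s₂ hs₁ hs₁₂ hs₂ h1 h2 ih.1 ih.2.1
      have hsum := ih.2.2.add e3
      rw [add_zero] at hsum
      exact ⟨e1, e2, tendsto_of_tendsto_of_tendsto_of_le_of_le tendsto_const_nhds hsum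
        (fun _ => zero_le) fun n => e1Norm_Icc_le_add hs₁ hs₁₂ _⟩)
  exact ⟨hend.1, hend.2.2⟩

end MaxReg

/-! ### The theorem -/

theorem theorem3p2 {X₀ X₁ : Type*}
    [NormedAddCommGroup X₀] [NormedSpace ℝ X₀] [CompleteSpace X₀]
    [NormedAddCommGroup X₁] [NormedSpace ℝ X₁] [CompleteSpace X₁]
    (j : X₁ →L[ℝ] X₀) (hj : Function.Injective j) (hj_dense : DenseRange j)
    (p : ℝ≥0∞) [Fact (1 ≤ p)] (hp_one : 1 < p) (hp_top : p < ∞) (t₀ : ℝ)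
    (A : ℕ∞ → ℝ → Xp j p → X₁ →L[ℝ] X₀) (f : ℕ∞ → ℝ → Xp j p → X₀)
    (hAf : ∀ n, Assumptions j p t₀ (A n) (f n))
    (hconv : ∀ ε : ℝ, 0 < ε → ∀ a b : ℝ, t₀ ≤ a → a ≤ b → ∀ η : ℝ, 0 < η →
      ∃ N : ℕ, ∀ n : ℕ, N ≤ n → ∀ t ∈ Icc a b, ∀ u : Xp j p, ‖u‖ ≤ η →
        ‖f n t u - f ⊤ t u‖ < ε ∧ ‖A n t u - A ⊤ t u‖ < ε)
    (u₀ : ℕ∞ → Xp j p)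
    (hu₀ : Tendsto (fun n : ℕ => ‖u₀ n - u₀ ⊤‖) atTop (𝓝 0))
    (T : ℕ∞ → ℝ≥0∞) (φ : ℕ∞ → ℝ → Xp j p)
    (hφ : ∀ n, IsMaximalSolution j p t₀ (A n) (f n) (u₀ n) (T n) (φ n)) :
    (∀ a b : ℝ, t₀ ≤ a → a ≤ b → ENNReal.ofReal (b - t₀) < T ⊤ →
      (∀ᶠ n : ℕ in atTop, ENNReal.ofReal (b - t₀) < T n) ∧
      Tendsto (fun n : ℕ => e1Norm j p (Icc a b) fun t => (φ n t).toX₀ - (φ ⊤ t).toX₀)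
        atTop (𝓝 0)) ∧
    T ⊤ ≤ limsup (fun n : ℕ => T n) atTop := by
  have main : ∀ b : ℝ, t₀ ≤ b → ENNReal.ofReal (b - t₀) < T ⊤ →
      (∀ᶠ n : ℕ in atTop, ENNReal.ofReal (b - t₀) < T n) ∧
      Tendsto (fun n : ℕ => e1Norm j p (Icc t₀ b) fun t => (φ n t).toX₀ - (φ ⊤ t).toX₀)
        atTop (𝓝 0) := fun b hb hbT =>
    tendsto_e1Norm_of_isMaximalSolution (A := fun n : ℕ => A n) (f := fun n : ℕ => f n)
      (T := fun n : ℕ => T n) (ψ := fun n : ℕ => φ n) hj hp_top.ne hb (fun n => hAf n) (hAf ⊤)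
      (fun ε η hε hη => by
        obtain ⟨N, hN⟩ := hconv ε hε t₀ b le_rfl hb η hη
        filter_upwards [eventually_ge_atTop N] with n hn t ht u hu
        exact ⟨(hN n hn t ht u hu).1.le, (hN n hn t ht u hu).2.le⟩)
      hu₀ (fun n => hφ n) ((hφ ⊤).1 b hb hbT)
  refine ⟨fun a b ha hab hbT => ?_, ?_⟩
  · obtain ⟨h1, h2⟩ := main b (ha.trans hab) hbT
    exact ⟨h1, tendsto_of_tendsto_of_tendsto_of_le_of_le tendsto_const_nhds h2
      (fun _ => zero_le) fun n => e1Norm_mono (Icc_subset_Icc_left ha) _⟩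
  -- Any `d` with `c < d < T ⊤` is finite, so `[t₀, t₀ + d]` is a compact interval to which the
  -- first part applies: eventually `d < T n`. This also covers `T ⊤ = ∞`.
  · refine le_of_forall_lt fun c hc => ?_
    obtain ⟨d, hcd, hdT⟩ := exists_between hc
    have hd : ENNReal.ofReal (t₀ + d.toReal - t₀) = d := by
      rw [add_sub_cancel_left, ENNReal.ofReal_toReal hdT.ne_top]
    have h1 := (main (t₀ + d.toReal) (by simp) (by rwa [hd])).1
    rw [hd] at h1
    refine hcd.trans_le (le_limsup_of_frequently_le ?_)
    exact (h1.mono fun n hn => hn.le).frequently
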